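/- **Setting.** Let $m,p,s$ be natural numbers with $ps\le m$. $\|\cdot\|$ is the induced 2-norm, and $\kappa(A)=\sigma_{\max}(A)/\sigma_{\min}(A)$ is the 2-norm condition number, with $\kappa(A)=\infty$ if $A$ does not have full column rank. Floating-point arithmetic with unit roundoff $\varepsilon>0$ follows the standard model: every addition and multiplication returns the exact result times $1+\delta$ with some $|\delta|\le\varepsilon$. Matrix products and sums are formed conventionally from scalar operations, with sums evaluated in any order. An intraorthogonalization routine $\mathrm{IO}$ maps each $\boldsymbol X\in\mathbb R^{m\times s}$ to computed factors $\bar{\boldsymbol Q}\in\mathbb R^{m\times s}$, $\bar R\in\mathbb R^{s\times s}$. **Algorithm BCGSI+A.** Given $\mathcal X=[\boldsymbol X_1\ \cdots\ \boldsymbol X_p]\in\mathbb R^{m\times ps}$ with $m\times s$ blocks and routines $\mathrm{IO}_A,\mathrm{IO}_1,\mathrm{IO}_2$, set $[\boldsymbol Q_1,R_{11}]=\mathrm{IO}_A(\boldsymbol X_1)$. For $k=2,\dots,p$, with $\mathcal Q_{k-1}=[\boldsymbol Q_1\ \cdots\ \boldsymbol Q_{k-1}]$, compute $$S_{1:k-1,k}=\mathcal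 Q_{k-1}^T\boldsymbol X_k,\qquad [\boldsymbol U_k,S_{kk}]=\mathrm{IO}_1(\boldsymbol X_k-\mathcal Q_{k-1}S_{1:k-1,k}),$$ $$T_{1:k-1,k}=\mathcal Q_{k-1}^T\boldsymbol U_k,\qquad [\boldsymbol Q_k,T_{kk}]=\mathrm{IO}_2(\boldsymbol U_k-\mathcal Q_{k-1}T_{1:k-1,k}),$$ $$R_{1:k-1,k}=S_{1:k-1,k}+T_{1:k-1,k}S_{kk},\qquad R_{kk}=T_{kk}S_{kk}.$$ Return $\mathcal Q=[\boldsymbol Q_1\ \cdots\ \boldsymbol Q_p]$ and the block upper triangular matrix $\mathcal R=(R_{ij})$. **Theorem.** Let $\alpha_1,\alpha_2\in\mathbb R$, $c>0$ and $\tau>1$, and put $\theta=\max(\alpha_1,1)$. There are constants $K,C>0$, depending only on $m,p,s,\alpha_1,\alpha_2,c,\tau$, such that the following holds for every $\varepsilon>0$, every $\mathcal X\in\mathbb R^{m\times ps}$ and all routines $\mathrm{IO}_A,\mathrm{IO}_1,\mathrm{IO}_2$. Assume that 1. for every $\boldsymbol X\in\mathbb R^{m\times s}$ with $\kappa(\boldsymbol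 X)\le\kappa(\mathcal X)$, the factors $[\bar{\boldsymbol Q},\bar R]=\mathrm{IO}_A(\boldsymbol X)$ satisfy $\boldsymbol X+\Delta\boldsymbol X=\bar{\boldsymbol Q}\bar R$ for some $\Delta\boldsymbol X$ with $\|\Delta\boldsymbol X\|\le c\,\varepsilon\|\boldsymbol X\|$, and $\|I-\bar{\boldsymbol Q}^T\bar{\boldsymbol Q}\|\le c\,\varepsilon$; 2. for $i=1,2$ and every $\boldsymbol X\in\mathbb R^{m\times s}$ with $\kappa(\boldsymbol X)\le\tau\,\kappa(\mathcal X)$, the factors $[\bar{\boldsymbol Q},\bar R]=\mathrm{IO}_i(\boldsymbol X)$ satisfy $\boldsymbol X+\Delta\boldsymbol X=\bar{\boldsymbol Q}\bar R$ for some $\Delta\boldsymbol X$ with $\|\Delta\boldsymbol X\|\le c\,\varepsilon\|\boldsymbol X\|$, and $\|I-\bar{\boldsymbol Q}^T\bar{\boldsymbol Q}\|\le c\,\varepsilon\,\kappa^{\alpha_i}(\boldsymbol X)$. If $K\varepsilon\,\kappa^{\theta}(\mathcal X)<1$, then any factors $\bar{\mathcal Q},\bar{\mathcal R}$ computed by BCGSI+A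 from $\mathcal X$ in floating-point arithmetic with unit roundoff $\varepsilon$ satisfy, for some $\Delta\mathcal X$, $$\mathcal X+\Delta\mathcal X=\bar{\mathcal Q}\bar{\mathcal R},\qquad \|\Delta\mathcal X\|\le C\varepsilon\|\mathcal X\|,\qquad\text{and}\qquad \|I-\bar{\mathcal Q}^T\bar{\mathcal Q}\|\le C\varepsilon.$$ Thus a routine with $O(\varepsilon)$ loss of orthogonality is needed only for the first block, and $\alpha_2$ enters neither the exponent $\theta$ nor the powers of $\varepsilon$ and $\kappa(\mathcal X)$ in the bounds. -/

import Mathlib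

open scoped Matrix Matrix.Norms.L2Operator ENNReal

noncomputable section

namespace BlockGS

/-! ### Singular values and the 2-norm condition number

Throughout, `‖A‖` for a real matrix `A` is the induced 2-norm. -/

/-- Largest singular value of `A`. -/
def sigmaMax {r n : Type*} [Fintype r] [Fintype n] [DecidableEq n] (A : Matrix r n ℝ) : ℝ :=
  (Matrix.toEuclideanLin A).singularValues 0

/-- Smallest singular value of a matrix `A` having at least as many rows as columns
(Mathlib's singular values are decreasing and indexed from `0`). -/
def sigmaMin {r n : Type*} [Fintype r] [Fintype n] [DecidableEq n] (A : Matrix r n ℝ) : ℝ :=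
  (Matrix.toEuclideanLin A).singularValues (Fintype.card n - 1)

/-- The 2-norm condition number `σ_max / σ_min`, equal to `∞` if `A` does not have full
column rank. -/
def kappa {r n : Type*} [Fintype r] [Fintype n] [DecidableEq n] (A : Matrix r n ℝ) : ℝ≥0∞ :=
  if sigmaMin A = 0 then ⊤ else ENNReal.ofReal (sigmaMax A / sigmaMin A)

/-! ### The standard model of floating-point arithmetic with unit roundoff `ε` -/

/-- `b` is a possible rounded value of `a`: `b = a (1 + δ)` for some `|δ| ≤ ε`. -/
def Rounds (ε a b : ℝ) : Prop := ∃ δ : ℝ, |δ| ≤ ε ∧ b = a * (1 + δ)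

/-- `FlSum ε t v`: the value `v` is a possible result of adding the terms of the multiset `t` in
floating-point arithmetic, in any order and with any parenthesization. -/
inductive FlSum (ε : ℝ) : Multiset ℝ → ℝ → Prop
  | zero : FlSum ε 0 0
  | single (a : ℝ) : FlSum ε {a} a
  | add {t₁ t₂ : Multiset ℝ} {a b c : ℝ} (h₁ : t₁ ≠ 0) (h₂ : t₂ ≠ 0)
      (ha : FlSum ε t₁ a) (hb : FlSum ε t₂ b) (hc : Rounds ε (a + b) c) : FlSum ε (t₁ + t₂) c

/-- `D` is a possible floating-point result of the matrix product `A * B`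
(conventional multiplication, inner products summed in any order). -/
def FlMul {r l n : Type*} [Fintype l] (ε : ℝ) (A : Matrix r l ℝ) (B : Matrix l n ℝ)
    (D : Matrix r n ℝ) : Prop :=
  ∀ i j, ∃ q : l → ℝ, (∀ a, Rounds ε (A i a * B a j) (q a)) ∧
    FlSum ε (Finset.univ.val.map q) (D i j)

/-- `D` is a possible floating-point result of `C + A * B`. The summation order is again
arbitrary, so that forming the product first and accumulating onto `C` are both included. -/
def FlAddMul {r l n : Type*} [Fintype l] (ε : ℝ) (C : Matrix r n ℝ) (A : Matrix r l ℝ)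
    (B : Matrix l n ℝ) (D : Matrix r n ℝ) : Prop :=
  ∀ i j, ∃ q : l → ℝ, (∀ a, Rounds ε (A i a * B a j) (q a)) ∧
    FlSum ε (C i j ::ₘ Finset.univ.val.map q) (D i j)

/-! ### Block notation

A matrix with `p` block columns of width `s` has columns indexed by `Fin p × Fin s`. -/

/-- Block column `k` of an `m × ps` matrix. -/
def blockCol {m p s : ℕ} (A : Matrix (Fin m) (Fin p × Fin s) ℝ) (k : Fin p) :
    Matrix (Fin m) (Fin s) ℝ :=
  A.submatrix id (fun b => (k, b))

/-- The block columns strictly before block column `k` of an `m × ps` matrix. -/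
def prevCols {m p s : ℕ} (A : Matrix (Fin m) (Fin p × Fin s) ℝ) (k : Fin p) :
    Matrix (Fin m) ({j : Fin p // j < k} × Fin s) ℝ :=
  A.submatrix id (fun a => (a.1.val, a.2))

/-- The `s × s` block in position `(i, k)` of a `ps × ps` matrix. -/
def block {p s : ℕ} (A : Matrix (Fin p × Fin s) (Fin p × Fin s) ℝ) (i k : Fin p) :
    Matrix (Fin s) (Fin s) ℝ :=
  A.submatrix (fun a => (i, a)) (fun b => (k, b))

/-- The part of block column `k` of a `ps × ps` matrix strictly above its diagonal block. -/
def aboveDiag {p s : ℕ} (A : Matrix (Fin p × Fin s) (Fin p × Fin s) ℝ) (k : Fin p) :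
    Matrix ({j : Fin p // j < k} × Fin s) (Fin s) ℝ :=
  A.submatrix (fun a => (a.1.val, a.2)) (fun b => (k, b))

/-! ### Intraorthogonalization routines -/

/-- An intraorthogonalization routine for `m × s` block vectors: it maps a block vector `X` to the
computed factors `(Q, R)`. -/
abbrev IntraOrtho (m s : ℕ) : Type :=
  Matrix (Fin m) (Fin s) ℝ → Matrix (Fin m) (Fin s) ℝ × Matrix (Fin s) (Fin s) ℝ

/-- For all block vectors `X` with `κ(X) ≤ κmax`, the routine has backward error at most
`c ε` relative to `‖X‖`, and loss of orthogonality at most `c ε κ(X) ^ α`. -/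
def IntraOrtho.Stable {m s : ℕ} (f : IntraOrtho m s) (c ε α : ℝ) (κmax : ℝ≥0∞) : Prop :=
  ∀ X : Matrix (Fin m) (Fin s) ℝ, kappa X ≤ κmax →
    (∃ ΔX : Matrix (Fin m) (Fin s) ℝ, X + ΔX = (f X).1 * (f X).2 ∧ ‖ΔX‖ ≤ c * ε * ‖X‖) ∧
    ENNReal.ofReal ‖1 - (f X).1ᵀ * (f X).1‖ ≤ ENNReal.ofReal (c * ε) * kappa X ^ α

/-! ### The algorithm BCGSI+A in floating-point arithmetic -/

/-- `Q`, `R`, with the auxiliary quantities `S`, `T`, `U`, `V`, `H`, form a possible run in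
floating-point arithmetic of block classical Gram-Schmidt with inner reorthogonalization
applied to `X`, with routine `IOA` for the first block and `IO1`, `IO2` for the other ones.
Block indices start at `0`. -/
structure BCGSIARun {m p s : ℕ} (ε : ℝ) (IOA IO1 IO2 : IntraOrtho m s)
    (X Q : Matrix (Fin m) (Fin p × Fin s) ℝ)
    (R S T : Matrix (Fin p × Fin s) (Fin p × Fin s) ℝ)
    (U V H : Matrix (Fin m) (Fin p × Fin s) ℝ) : Prop where
  /-- `[Q₁, R₁₁] = IO_A(X₁)` -/
  first : ∀ k : Fin p, k.val = 0 → (blockCol Q k, block R k k) = IOA (blockCol X k)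
  /-- `S_{1:k-1,k} = Q_{1:k-1}ᵀ X_k` -/
  proj1 : ∀ k : Fin p, 0 < k.val →
    FlMul ε (prevCols Q k)ᵀ (blockCol X k) (aboveDiag S k)
  /-- `V_k = X_k - Q_{1:k-1} S_{1:k-1,k}` -/
  sub1 : ∀ k : Fin p, 0 < k.val →
    FlAddMul ε (blockCol X k) (-prevCols Q k) (aboveDiag S k) (blockCol V k)
  /-- `[U_k, S_kk] = IO_1(V_k)` -/
  ortho1 : ∀ k : Fin p, 0 < k.val → (blockCol U k, block S k k) = IO1 (blockCol V k)
  /-- `T_{1:k-1,k} = Q_{1:k-1}ᵀ U_k` -/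
  proj2 : ∀ k : Fin p, 0 < k.val →
    FlMul ε (prevCols Q k)ᵀ (blockCol U k) (aboveDiag T k)
  /-- `H_k = U_k - Q_{1:k-1} T_{1:k-1,k}` -/
  sub2 : ∀ k : Fin p, 0 < k.val →
    FlAddMul ε (blockCol U k) (-prevCols Q k) (aboveDiag T k) (blockCol H k)
  /-- `[Q_k, T_kk] = IO_2(H_k)` -/
  ortho2 : ∀ k : Fin p, 0 < k.val → (blockCol Q k, block T k k) = IO2 (blockCol H k)
  /-- `R_{1:k-1,k} = S_{1:k-1,k} + T_{1:k-1,k} S_kk` -/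
  upper : ∀ k : Fin p, 0 < k.val →
    FlAddMul ε (aboveDiag S k) (aboveDiag T k) (block S k k) (aboveDiag R k)
  /-- `R_kk = T_kk S_kk` -/
  diag : ∀ k : Fin p, 0 < k.val → FlMul ε (block T k k) (block S k k) (block R k k)
  /-- the blocks of `R` below the block diagonal vanish -/
  lower : ∀ i k : Fin p, k < i → block R i k = 0

/-- `Q` and `R` are possible computed results of BCGSI+A applied to `X` in floating-point
arithmetic with unit roundoff `ε`. -/
def IsComputedBCGSIA {m p s : ℕ} (ε : ℝ) (IOA IO1 IO2 : IntraOrtho m s)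
    (X Q : Matrix (Fin m) (Fin p × Fin s) ℝ)
    (R : Matrix (Fin p × Fin s) (Fin p × Fin s) ℝ) : Prop :=
  ∃ S T U V H, BCGSIARun ε IOA IO1 IO2 X Q R S T U V H

end BlockGS

end

/-! Put x = ‖X‖, σ = σ_min(X), κ = x/σ and ω = εκ^θ. The proof is an induction over block columns
(`exists_leading_bound`): on the columns already computed, Q is orthonormal to O(ε) and X - QR is
O(εx). The constants grow from block to block, but there are only p blocks.
`exists_block_step_bound` carries the induction step, as follows.

The first projection V = X_k - QS cannot be much worse conditioned than X. Up to residual errors, Vv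
is X applied to a vector whose k-th block is v, so ‖Vv‖ ≥ (1 - O(ω))σ‖v‖
(`boundedBelow_projection`), while ‖V‖ ≤ (1 + O(ω))x. For small ω this gives κ(V) ≤ τκ, so `IO1`
applies and U is orthonormal to O(ω). Moreover QᵀV = O(εx), and cancelling S_kk, which is bounded
below by a multiple of σ, gives QᵀU = O(εκ) = O(ω) (`intraortho_step`). This is where θ ≥ 1 is
needed.

Hence the second projection moves U by only O(ω), and its result H satisfies κ(H) ≤ τ, a bound free
of κ. Whatever α₂ is, `IO2` therefore loses only O(ε) orthogonality. The cancellation of T_kk, now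
bounded below by a constant, yields QᵀQ_k = O(ε). The residual of the new block is a sum of local
errors (`residual_step`). -/

namespace BlockGS

open Matrix

/-! ### Extremal characterization of singular values. -/

section SingularValues

variable {E F : Type*} [NormedAddCommGroup E] [InnerProductSpace ℝ E] [FiniteDimensional ℝ E]
  [NormedAddCommGroup F] [InnerProductSpace ℝ F] [FiniteDimensional ℝ F]

/-- The squared norm of `T v` in the basis of right singular vectors. -/
theorem norm_sq_apply_eq_sum_singularValues (T : E →ₗ[ℝ] F) {N : ℕ}
    (hN : Module.finrank ℝ E = N) (v : E) :
    ‖T v‖ ^ 2 = ∑ i : Fin N, T.singularValues i ^ 2 *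
      inner ℝ (T.isSymmetric_adjoint_comp_self.eigenvectorBasis hN i) v ^ 2 := by
  set b := T.isSymmetric_adjoint_comp_self.eigenvectorBasis hN with hb
  have h1 : ‖T v‖ ^ 2 = inner ℝ v ((LinearMap.adjoint T ∘ₗ T) v) := by
    rw [LinearMap.comp_apply, LinearMap.adjoint_inner_right, real_inner_self_eq_norm_sq]
  rw [h1, ← b.sum_inner_mul_inner]
  refine Finset.sum_congr rfl fun i _ => ?_
  have h2 := T.isSymmetric_adjoint_comp_self.eigenvectorBasis_apply_self_apply hN v i
  rw [← hb, b.repr_apply_apply, b.repr_apply_apply] at h2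
  rw [h2, T.sq_singularValues_fin hN, real_inner_comm]
  simp only [RCLike.ofReal_real_eq_id, id]
  ring

theorem norm_apply_le_singularValues_zero (T : E →ₗ[ℝ] F) (v : E) :
    ‖T v‖ ≤ T.singularValues 0 * ‖v‖ := by
  refine le_of_sq_le_sq ?_ (mul_nonneg (T.singularValues_nonneg 0) (norm_nonneg v))
  rw [norm_sq_apply_eq_sum_singularValues T rfl v, mul_pow,
    ← (T.isSymmetric_adjoint_comp_self.eigenvectorBasis rfl).sum_sq_inner_right v,
    Finset.mul_sum]
  gcongr with i
  · exact T.singularValues_nonneg _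
  · exact T.singularValues_antitone (Nat.zero_le _)

theorem singularValues_last_mul_norm_le (T : E →ₗ[ℝ] F) (v : E) :
    T.singularValues (Module.finrank ℝ E - 1) * ‖v‖ ≤ ‖T v‖ := by
  refine le_of_sq_le_sq ?_ (norm_nonneg _)
  rw [norm_sq_apply_eq_sum_singularValues T rfl v, mul_pow,
    ← (T.isSymmetric_adjoint_comp_self.eigenvectorBasis rfl).sum_sq_inner_right v,
    Finset.mul_sum]
  gcongr with i
  · exact T.singularValues_nonneg _
  · exact T.singularValues_antitone (by omega)

/-- Every singular value with index below the dimension is attained. -/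
theorem exists_norm_apply_eq_singularValues (T : E →ₗ[ℝ] F) {k : ℕ}
    (hk : k < Module.finrank ℝ E) : ∃ v : E, ‖v‖ = 1 ∧ ‖T v‖ = T.singularValues k := by
  set b := T.isSymmetric_adjoint_comp_self.eigenvectorBasis rfl with hb
  refine ⟨b ⟨k, hk⟩, b.orthonormal.norm_eq_one _, ?_⟩
  rw [← sq_eq_sq₀ (norm_nonneg _) (T.singularValues_nonneg _),
    norm_sq_apply_eq_sum_singularValues T rfl, ← hb]
  simp [orthonormal_iff_ite.mp b.orthonormal]

end SingularValues

/-! ### Spectral norms and lower bounds of matrices. -/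

/-- The Euclidean norm of a vector. -/
noncomputable def euclNorm {n : Type*} [Fintype n] (v : n → ℝ) : ℝ := ‖WithLp.toLp 2 v‖

/-- `A` stretches every vector by at least the factor `μ`. -/
def BoundedBelow {r n : Type*} [Fintype r] [Fintype n] (A : Matrix r n ℝ) (μ : ℝ) : Prop :=
  ∀ v : n → ℝ, μ * euclNorm v ≤ euclNorm (A *ᵥ v)

/-- The columns of the identity matrix selected by an injective map are orthonormal. -/
theorem one_submatrix_transpose_mul_self {l n : Type*} [Fintype n] [DecidableEq l]
    [DecidableEq n] {f : l → n} (hf : Function.Injective f) :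
    ((1 : Matrix n n ℝ).submatrix id f)ᵀ * (1 : Matrix n n ℝ).submatrix id f = 1 := by
  ext i j
  simp [Matrix.mul_apply, Matrix.one_apply, hf.eq_iff]

theorem submatrix_col_eq_mul {r l n : Type*} [Fintype n] [DecidableEq n] (A : Matrix r n ℝ) (f : l → n) :
    A.submatrix id f = A * (1 : Matrix n n ℝ).submatrix id f := by
  ext i j
  simp [Matrix.mul_apply, Matrix.one_apply]

section Norms

variable {r l n : Type*} [Fintype r] [Fintype l] [Fintype n]

theorem euclNorm_nonneg (v : n → ℝ) : 0 ≤ euclNorm v := norm_nonneg _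

theorem euclNorm_sub_le (v w : n → ℝ) : euclNorm v - euclNorm w ≤ euclNorm (v - w) := by
  simpa [euclNorm] using norm_sub_norm_le (WithLp.toLp 2 v) (WithLp.toLp 2 w)

theorem euclNorm_sq (v : n → ℝ) : euclNorm v ^ 2 = v ⬝ᵥ v := by
  rw [euclNorm, EuclideanSpace.norm_sq_eq]
  simp [dotProduct, sq]

theorem euclNorm_eq_zero {v : n → ℝ} : euclNorm v = 0 ↔ v = 0 := by
  simp [euclNorm]

theorem abs_dotProduct_le_euclNorm_mul (v w : n → ℝ) : |v ⬝ᵥ w| ≤ euclNorm v * euclNorm w := by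
  have := abs_real_inner_le_norm (WithLp.toLp 2 w) (WithLp.toLp 2 v)
  rw [mul_comm]
  simpa [euclNorm, PiLp.inner_apply, dotProduct] using this

theorem mulVec_dotProduct_mulVec (A : Matrix r l ℝ) (B : Matrix r n ℝ) (v : l → ℝ) (w : n → ℝ) :
    A *ᵥ v ⬝ᵥ B *ᵥ w = v ⬝ᵥ (Aᵀ * B) *ᵥ w := by
  rw [← Matrix.mulVec_mulVec, Matrix.dotProduct_mulVec v, Matrix.vecMul_transpose]

variable [DecidableEq l] [DecidableEq n]

theorem euclNorm_mulVec_le (A : Matrix r n ℝ) (v : n → ℝ) :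
    euclNorm (A *ᵥ v) ≤ ‖A‖ * euclNorm v :=
  A.l2_opNorm_mulVec (WithLp.toLp 2 v)

theorem l2_opNorm_le_of_forall {A : Matrix r n ℝ} {a : ℝ} (ha : 0 ≤ a)
    (h : ∀ v, euclNorm (A *ᵥ v) ≤ a * euclNorm v) : ‖A‖ ≤ a :=
  ContinuousLinearMap.opNorm_le_bound _ ha fun v => h (WithLp.ofLp v)

theorem abs_entry_le_l2_opNorm (A : Matrix r n ℝ) (i : r) (j : n) : |A i j| ≤ ‖A‖ := by
  have h := euclNorm_mulVec_le A (Pi.single j 1)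
  have h1 : euclNorm (Pi.single j (1 : ℝ) : n → ℝ) = 1 := by simp [euclNorm]
  have h2 : |A i j| ≤ euclNorm (A *ᵥ Pi.single j 1) := by
    have := PiLp.norm_apply_le (WithLp.toLp 2 (A *ᵥ Pi.single j 1)) i
    simpa [euclNorm] using this
  rw [h1, mul_one] at h
  exact h2.trans h

/-- An entrywise bound gives a bound of the 2-norm. -/
theorem l2_opNorm_le_of_entry_le {A : Matrix r n ℝ} {a : ℝ} (ha : 0 ≤ a)
    (h : ∀ i j, |A i j| ≤ a) : ‖A‖ ≤ Fintype.card r * Fintype.card n * a := by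
  classical
  have hsingle : ∀ i j, ‖Matrix.single i j (A i j)‖ ≤ a := fun i j => by
    refine l2_opNorm_le_of_forall ha fun v => ?_
    have h1 : euclNorm (Matrix.single i j (A i j) *ᵥ v) = |A i j| * |v j| := by
      rw [Matrix.single_mulVec]
      change ‖WithLp.toLp 2 (Pi.single i (A i j * v j) : r → ℝ)‖ = _
      simp
    rw [h1]
    have h2 : |v j| ≤ euclNorm v := by
      simpa [euclNorm] using PiLp.norm_apply_le (WithLp.toLp 2 v) j
    exact mul_le_mul (h i j) h2 (abs_nonneg _) ha
  rw [Matrix.matrix_eq_sum_single A]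
  refine (norm_sum_le _ _).trans ((Finset.sum_le_sum fun i _ => (norm_sum_le _ _).trans
    (Finset.sum_le_sum fun j _ => hsingle i j)).trans ?_)
  simp [mul_assoc]

theorem l2_opNorm_transpose [DecidableEq r] (A : Matrix r n ℝ) : ‖Aᵀ‖ = ‖A‖ := by
  rw [← Matrix.conjTranspose_eq_transpose_of_trivial, l2_opNorm_conjTranspose]

theorem l2_opNorm_one_le : ‖(1 : Matrix n n ℝ)‖ ≤ 1 :=
  l2_opNorm_le_of_forall zero_le_one fun v => by simp

theorem l2_opNorm_submatrix_col_le (A : Matrix r n ℝ) {f : l → n} (hf : Function.Injective f) :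
    ‖A.submatrix id f‖ ≤ ‖A‖ := by
  have h : ‖(1 : Matrix n n ℝ).submatrix id f‖ ≤ 1 := by
    have h1 := l2_opNorm_conjTranspose_mul_self ((1 : Matrix n n ℝ).submatrix id f)
    rw [Matrix.conjTranspose_eq_transpose_of_trivial, one_submatrix_transpose_mul_self hf] at h1
    have h2 := l2_opNorm_one_le (n := l)
    nlinarith [norm_nonneg ((1 : Matrix n n ℝ).submatrix id f)]
  rw [submatrix_col_eq_mul]
  exact (l2_opNorm_mul _ _).trans (mul_le_of_le_one_right (norm_nonneg _) h)

/-- A lower bound for a matrix controls both parts of a combination of two disjoint groups of its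
columns. -/
theorem BoundedBelow.disjoint_cols {m : Type*} [Fintype m] [DecidableEq m] {A : Matrix r n ℝ}
    {σ : ℝ} (hσ : 0 ≤ σ)
    (hA : BoundedBelow A σ) {f : l → n} {g : m → n} (hf : Function.Injective f)
    (hg : Function.Injective g) (hfg : ∀ i j, f i ≠ g j) (y : l → ℝ) (v : m → ℝ) :
    σ * euclNorm y ≤ euclNorm (A.submatrix id f *ᵥ y + A.submatrix id g *ᵥ v) ∧
      σ * euclNorm v ≤ euclNorm (A.submatrix id f *ᵥ y + A.submatrix id g *ᵥ v) := by
  set F := (1 : Matrix n n ℝ).submatrix id f with hF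
  set G := (1 : Matrix n n ℝ).submatrix id g with hG
  have hFG : Fᵀ * G = 0 := by
    ext i j
    simp [hF, hG, Matrix.mul_apply, Matrix.one_apply, hfg]
  have hGF : Gᵀ * F = 0 := by rw [← Matrix.transpose_transpose F, ← Matrix.transpose_mul, hFG,
    Matrix.transpose_zero]
  -- The two groups of columns are disjoint, so the coefficient vector assembled from y and v obeys
  -- Pythagoras and dominates each part.
  have hz : euclNorm (F *ᵥ y + G *ᵥ v) ^ 2 = euclNorm y ^ 2 + euclNorm v ^ 2 := by
    simp only [euclNorm_sq, add_dotProduct, dotProduct_add, mulVec_dotProduct_mulVec, hFG, hGF]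
    rw [one_submatrix_transpose_mul_self hf, one_submatrix_transpose_mul_self hg]
    simp
  have hA' := hA (F *ᵥ y + G *ᵥ v)
  have heq : A *ᵥ (F *ᵥ y + G *ᵥ v) = A.submatrix id f *ᵥ y + A.submatrix id g *ᵥ v := by
    rw [submatrix_col_eq_mul A f, submatrix_col_eq_mul A g, Matrix.mulVec_add,
      Matrix.mulVec_mulVec, Matrix.mulVec_mulVec]
  rw [heq] at hA'
  constructor <;> refine le_trans (mul_le_mul_of_nonneg_left ?_ hσ) hA' <;>
    refine le_of_sq_le_sq ?_ (euclNorm_nonneg _) <;>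
    nlinarith [sq_nonneg (euclNorm y), sq_nonneg (euclNorm v)]

end Norms

section BoundedBelow

variable {r l n : Type*} [Fintype r] [Fintype l] [Fintype n]

theorem BoundedBelow.mono {A : Matrix r n ℝ} {μ ν : ℝ} (hA : BoundedBelow A μ) (h : ν ≤ μ) :
    BoundedBelow A ν := fun v =>
  (mul_le_mul_of_nonneg_right h (euclNorm_nonneg v)).trans (hA v)

theorem BoundedBelow.mulVec_injective {A : Matrix r n ℝ} {μ : ℝ} (hμ : 0 < μ)
    (hA : BoundedBelow A μ) {v : n → ℝ} (h : A *ᵥ v = 0) : v = 0 := by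
  have := hA v
  rw [h, euclNorm_eq_zero.mpr rfl] at this
  rw [← euclNorm_eq_zero]
  nlinarith [euclNorm_nonneg v]

/-- A square matrix bounded below is surjective. -/
theorem BoundedBelow.mulVec_surjective {A : Matrix n n ℝ} {μ : ℝ} (hμ : 0 < μ)
    (hA : BoundedBelow A μ) : Function.Surjective A.mulVec := by
  have h : Function.Injective A.mulVecLin := by
    rw [← LinearMap.ker_eq_bot, LinearMap.ker_eq_bot']
    exact fun v hv => hA.mulVec_injective hμ hv
  exact LinearMap.injective_iff_surjective.mp h

theorem BoundedBelow.of_mul_left [DecidableEq l] {A : Matrix r l ℝ} {B : Matrix l n ℝ} {μ a : ℝ}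
    (h : BoundedBelow (A * B) μ) (ha : 0 < a) (hA : ‖A‖ ≤ a) : BoundedBelow B (μ / a) := fun v => by
  have h1 := h v
  rw [← Matrix.mulVec_mulVec] at h1
  have h2 := euclNorm_mulVec_le A (B *ᵥ v)
  rw [div_mul_eq_mul_div, div_le_iff₀ ha]
  nlinarith [euclNorm_nonneg (B *ᵥ v)]

theorem BoundedBelow.norm_right_le [DecidableEq n] {A : Matrix r l ℝ} {B : Matrix l n ℝ} {μ e : ℝ}
    (hA : BoundedBelow A μ) (hμ : 0 < μ) (h : ‖A * B‖ ≤ e) : ‖B‖ ≤ e / μ := by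
  refine l2_opNorm_le_of_forall (div_nonneg ((norm_nonneg _).trans h) hμ.le) fun v => ?_
  have h1 := hA (B *ᵥ v)
  rw [Matrix.mulVec_mulVec] at h1
  rw [div_mul_eq_mul_div, le_div_iff₀ hμ]
  nlinarith [euclNorm_mulVec_le (A * B) v, euclNorm_nonneg v]

variable [DecidableEq l] [DecidableEq n]

theorem BoundedBelow.perturb {A B : Matrix r n ℝ} {μ e : ℝ} (hA : BoundedBelow A μ)
    (h : ‖B - A‖ ≤ e) : BoundedBelow B (μ - e) := fun v => by
  have h1 := euclNorm_mulVec_le (B - A) v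
  have h2 := euclNorm_sub_le (A *ᵥ v) (-((B - A) *ᵥ v))
  have h3 : A *ᵥ v - -((B - A) *ᵥ v) = B *ᵥ v := by
    rw [Matrix.sub_mulVec]; abel
  have h4 : euclNorm (-((B - A) *ᵥ v)) = euclNorm ((B - A) *ᵥ v) := by simp [euclNorm]
  rw [h3, h4] at h2
  nlinarith [hA v, euclNorm_nonneg v]

/-- A square matrix bounded below is onto, so every w is Bv with ‖v‖ ≤ ‖w‖/μ. This is the
cancellation that turns a bound on QᵀUS into one on QᵀU. -/
theorem BoundedBelow.norm_left_le {A : Matrix r n ℝ} {B : Matrix n n ℝ} {μ e : ℝ}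
    (hB : BoundedBelow B μ) (hμ : 0 < μ) (h : ‖A * B‖ ≤ e) : ‖A‖ ≤ e / μ := by
  refine l2_opNorm_le_of_forall (div_nonneg ((norm_nonneg _).trans h) hμ.le) fun w => ?_
  obtain ⟨v, rfl⟩ := hB.mulVec_surjective hμ w
  have h1 := euclNorm_mulVec_le (A * B) v
  rw [Matrix.mulVec_mulVec, div_mul_eq_mul_div, le_div_iff₀ hμ]
  have h0 : 0 ≤ e := (norm_nonneg _).trans h
  nlinarith [hB v, euclNorm_nonneg v, mul_le_mul_of_nonneg_left (hB v) h0,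
    mul_le_mul_of_nonneg_right h (euclNorm_nonneg v)]

theorem abs_euclNorm_sq_sub_le (U : Matrix r n ℝ) (v : n → ℝ) :
    |euclNorm v ^ 2 - euclNorm (U *ᵥ v) ^ 2| ≤ ‖1 - Uᵀ * U‖ * euclNorm v ^ 2 := by
  have h : euclNorm v ^ 2 - euclNorm (U *ᵥ v) ^ 2 = v ⬝ᵥ (1 - Uᵀ * U) *ᵥ v := by
    rw [euclNorm_sq, euclNorm_sq, Matrix.sub_mulVec, dotProduct_sub, Matrix.one_mulVec,
      mulVec_dotProduct_mulVec]
  rw [h]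
  have := abs_dotProduct_le_euclNorm_mul v ((1 - Uᵀ * U) *ᵥ v)
  nlinarith [euclNorm_mulVec_le (1 - Uᵀ * U) v, euclNorm_nonneg v]

theorem norm_le_of_orthogonality {U : Matrix r n ℝ} {η : ℝ} (h : ‖1 - Uᵀ * U‖ ≤ η) :
    ‖U‖ ≤ 1 + η := by
  have h0 : 0 ≤ η := (norm_nonneg _).trans h
  refine l2_opNorm_le_of_forall (by linarith) fun v => ?_
  refine le_of_sq_le_sq ?_ (mul_nonneg (by linarith) (euclNorm_nonneg v))
  have h1 := (abs_le.mp (abs_euclNorm_sq_sub_le U v)).1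
  have h2 := mul_le_mul_of_nonneg_right h (sq_nonneg (euclNorm v))
  have h3 := mul_nonneg (sq_nonneg η) (sq_nonneg (euclNorm v))
  have h4 := mul_nonneg h0 (sq_nonneg (euclNorm v))
  nlinarith

/-- From ‖Uv‖² ≥ (1 - η)‖v‖² and (1 - η)² ≤ 1 - η; the weaker constant avoids square roots. -/
theorem BoundedBelow.of_orthogonality {U : Matrix r n ℝ} {η : ℝ} (h : ‖1 - Uᵀ * U‖ ≤ η)
    (hη : η ≤ 1) : BoundedBelow U (1 - η) := fun v => by
  have h0 : 0 ≤ η := (norm_nonneg _).trans h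
  refine le_of_sq_le_sq ?_ (euclNorm_nonneg _)
  have h1 := (abs_le.mp (abs_euclNorm_sq_sub_le U v)).2
  have h2 := mul_le_mul_of_nonneg_right h (sq_nonneg (euclNorm v))
  have h3 := mul_nonneg (mul_nonneg h0 (sub_nonneg.mpr hη)) (sq_nonneg (euclNorm v))
  nlinarith

/-- With u = Qᵀw, ‖w - Qu‖² = ‖w‖² - 2‖u‖² + ‖Qu‖², and ‖Qu‖² ≤ 2‖u‖². The leading constant 1
matters: κ(V) ≤ τκ(X) must hold for τ arbitrarily close to 1. -/
theorem norm_sub_mul_transpose_mul_le [DecidableEq r] {Q : Matrix r l ℝ} (h : ‖1 - Qᵀ * Q‖ ≤ 1)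
    (A : Matrix r n ℝ) : ‖A - Q * (Qᵀ * A)‖ ≤ ‖A‖ := by
  refine l2_opNorm_le_of_forall (norm_nonneg _) fun v => ?_
  refine le_trans ?_ (euclNorm_mulVec_le A v)
  set w := A *ᵥ v with hw
  set u := Qᵀ *ᵥ w with hu
  have h1 : (A - Q * (Qᵀ * A)) *ᵥ v = w - Q *ᵥ u := by
    rw [Matrix.sub_mulVec, hu, hw, Matrix.mulVec_mulVec, Matrix.mulVec_mulVec, Matrix.mul_assoc]
  rw [h1]
  refine le_of_sq_le_sq ?_ (euclNorm_nonneg _)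
  have h2 : euclNorm (w - Q *ᵥ u) ^ 2
      = euclNorm w ^ 2 - 2 * euclNorm u ^ 2 + euclNorm (Q *ᵥ u) ^ 2 := by
    have h3 : w ⬝ᵥ Q *ᵥ u = u ⬝ᵥ u := by
      rw [Matrix.dotProduct_mulVec, ← Matrix.mulVec_transpose, ← hu]
    simp only [euclNorm_sq, sub_dotProduct, dotProduct_sub, dotProduct_comm (Q *ᵥ u) w, h3]
    ring
  have h4 := (abs_le.mp (abs_euclNorm_sq_sub_le Q u)).1
  have h5 := mul_le_mul_of_nonneg_right h (sq_nonneg (euclNorm u))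
  rw [h2]
  linarith

end BoundedBelow

/-! ### The condition number in terms of norm and lower bound. -/

section Kappa

variable {r n : Type*} [Fintype r] [Fintype n] [DecidableEq n]

theorem sigmaMin_mul_euclNorm_le (A : Matrix r n ℝ) : BoundedBelow A (sigmaMin A) := fun v => by
  have := singularValues_last_mul_norm_le (Matrix.toEuclideanLin A) (WithLp.toLp 2 v)
  rwa [finrank_euclideanSpace] at this

theorem sigmaMax_nonneg (A : Matrix r n ℝ) : 0 ≤ sigmaMax A :=
  LinearMap.singularValues_nonneg _ _

theorem sigmaMin_nonneg (A : Matrix r n ℝ) : 0 ≤ sigmaMin A :=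
  LinearMap.singularValues_nonneg _ _

theorem sigmaMin_le_sigmaMax (A : Matrix r n ℝ) : sigmaMin A ≤ sigmaMax A :=
  LinearMap.singularValues_antitone _ (Nat.zero_le _)

theorem norm_le_sigmaMax (A : Matrix r n ℝ) : ‖A‖ ≤ sigmaMax A :=
  l2_opNorm_le_of_forall (sigmaMax_nonneg A) fun v =>
    norm_apply_le_singularValues_zero (Matrix.toEuclideanLin A) (WithLp.toLp 2 v)


theorem one_le_kappa (A : Matrix r n ℝ) : 1 ≤ kappa A := by
  rw [kappa]
  split_ifs with h
  · exact le_top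
  · rw [ENNReal.one_le_ofReal, one_le_div ((sigmaMin_nonneg A).lt_of_ne' h)]
    exact sigmaMin_le_sigmaMax A

variable [Nonempty n]

theorem sigmaMax_eq_norm (A : Matrix r n ℝ) : sigmaMax A = ‖A‖ := by
  refine le_antisymm ?_ (norm_le_sigmaMax A)
  obtain ⟨v, hv, h⟩ := exists_norm_apply_eq_singularValues (Matrix.toEuclideanLin A) (k := 0)
    (by rw [finrank_euclideanSpace]; exact Fintype.card_pos)
  have := euclNorm_mulVec_le A (WithLp.ofLp v)
  rw [sigmaMax, ← h]
  simp only [euclNorm, WithLp.toLp_ofLp, hv, mul_one] at this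
  exact this

/-- The smallest singular value is attained at a unit vector. This requires a column: without
columns every μ is a lower bound. -/
theorem BoundedBelow.le_sigmaMin {A : Matrix r n ℝ} {μ : ℝ} (hA : BoundedBelow A μ) :
    μ ≤ sigmaMin A := by
  obtain ⟨v, hv, h⟩ := exists_norm_apply_eq_singularValues (Matrix.toEuclideanLin A)
    (k := Fintype.card n - 1)
    (by rw [finrank_euclideanSpace]; exact Nat.sub_lt Fintype.card_pos one_pos)
  have := hA (WithLp.ofLp v)
  rw [sigmaMin, ← h]
  simp only [euclNorm, WithLp.toLp_ofLp, hv, mul_one] at this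
  exact this

theorem BoundedBelow.kappa_le {A : Matrix r n ℝ} {μ M : ℝ} (hA : BoundedBelow A μ) (hμ : 0 < μ)
    (hM : ‖A‖ ≤ M) : kappa A ≤ ENNReal.ofReal (M / μ) := by
  have h := hA.le_sigmaMin
  rw [kappa, if_neg (hμ.trans_le h).ne', sigmaMax_eq_norm]
  exact ENNReal.ofReal_le_ofReal (div_le_div₀ ((norm_nonneg _).trans hM) hM hμ h)

theorem kappa_eq_of_ne_top {A : Matrix r n ℝ} (h : kappa A ≠ ⊤) :
    0 < sigmaMin A ∧ sigmaMin A ≤ ‖A‖ ∧ kappa A = ENNReal.ofReal (‖A‖ / sigmaMin A) := by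
  rw [← sigmaMax_eq_norm]
  rw [kappa] at h ⊢
  split_ifs at h ⊢ with h0
  · exact absurd rfl h
  · exact ⟨(sigmaMin_nonneg A).lt_of_ne' h0, sigmaMin_le_sigmaMax A, rfl⟩

end Kappa

/-! ### Rounding errors of sums and matrix products -/

/-- By induction on the summation tree. The bound sees only the number of terms, so it covers every
order and parenthesization. -/
theorem FlSum.abs_sub_sum_le {ε : ℝ} (hε : 0 ≤ ε) {t : Multiset ℝ} {v : ℝ} (h : FlSum ε t v) :
    |v - t.sum| ≤ ((1 + ε) ^ t.card - 1) * (t.map abs).sum := by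
  induction h with
  | zero => simp
  | single a => simpa using mul_nonneg hε (abs_nonneg a)
  | @add t₁ t₂ a b c h₁ h₂ _ _ hc iha ihb =>
    obtain ⟨δ, hδ, rfl⟩ := hc
    have habs : ∀ t : Multiset ℝ, |t.sum| ≤ (t.map abs).sum := fun t => Multiset.abs_sum_le_sum_abs
    have hA : ∀ t : Multiset ℝ, 0 ≤ (t.map abs).sum := fun t => (abs_nonneg _).trans (habs t)
    -- Both subtrees are nonempty, so each has a factor 1 + ε to spare for the final rounding.
    have hpow : ∀ {i : ℕ}, i + 1 ≤ t₁.card + t₂.card →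
        (1 + ε) * (1 + ε) ^ i ≤ (1 + ε) ^ (t₁.card + t₂.card) := fun {i} hi => by
      rw [← pow_succ']; exact pow_le_pow_right₀ (by linarith) hi
    have hp₁ := hpow (i := t₁.card) (Nat.add_le_add_left (Multiset.card_pos.mpr h₂) _)
    have hp₂ := hpow (i := t₂.card)
      (by rw [add_comm]; exact Nat.add_le_add_right (Multiset.card_pos.mpr h₁) _)
    rw [Multiset.sum_add, Multiset.card_add, Multiset.map_add, Multiset.sum_add]
    have hdec : (a + b) * (1 + δ) - (t₁.sum + t₂.sum)
        = (1 + δ) * ((a - t₁.sum) + (b - t₂.sum)) + δ * (t₁.sum + t₂.sum) := by ring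
    have h1 : |1 + δ| ≤ 1 + ε := (abs_add_le _ _).trans (by simpa using hδ)
    have h2 : |(a - t₁.sum) + (b - t₂.sum)| ≤ ((1 + ε) ^ t₁.card - 1) * (t₁.map abs).sum
        + ((1 + ε) ^ t₂.card - 1) * (t₂.map abs).sum :=
      (abs_add_le _ _).trans (add_le_add iha ihb)
    have h3 : |t₁.sum + t₂.sum| ≤ (t₁.map abs).sum + (t₂.map abs).sum :=
      (abs_add_le _ _).trans (add_le_add (habs _) (habs _))
    rw [hdec]
    refine (abs_add_le _ _).trans ?_
    rw [abs_mul, abs_mul]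
    refine (add_le_add (mul_le_mul h1 h2 (abs_nonneg _) (by linarith))
      (mul_le_mul hδ h3 (abs_nonneg _) hε)).trans ?_
    nlinarith [mul_le_mul_of_nonneg_right hp₁ (hA t₁), mul_le_mul_of_nonneg_right hp₂ (hA t₂)]

theorem one_add_pow_sub_one_le {ε : ℝ} (hε : 0 ≤ ε) (hε1 : ε ≤ 1) (N : ℕ) :
    (1 + ε) ^ N - 1 ≤ (2 ^ N - 1) * ε := by
  induction N with
  | zero => simp
  | succ N ih =>
    have h2 : (1 : ℝ) ≤ 2 ^ N := one_le_pow₀ (by norm_num)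
    rw [pow_succ, pow_succ]
    nlinarith [mul_le_mul_of_nonneg_left ih (by linarith : 0 ≤ 1 + ε),
      mul_nonneg (mul_nonneg hε (sub_nonneg.mpr hε1)) (sub_nonneg.mpr h2)]

/-- Rounding error of an accumulated inner product. -/
theorem abs_flSum_products_le {l : Type*} [Fintype l] {ε : ℝ} (hε : 0 ≤ ε) (hε1 : ε ≤ 1)
    {u w q : l → ℝ} (hq : ∀ a, Rounds ε (u a * w a) (q a)) {s : Multiset ℝ} {d β γ : ℝ}
    (hβ : ∀ a, |u a * w a| ≤ β) (hγ : (s.map abs).sum ≤ γ) (hs : s.card ≤ 1)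
    (hd : FlSum ε (s + Finset.univ.val.map q) d) :
    |d - (s.sum + ∑ a, u a * w a)| ≤
      2 ^ (Fintype.card l + 3) * ε * (γ + Fintype.card l * β) := by
  have h1 := hd.abs_sub_sum_le hε
  have hq1 : ∀ a, |q a - u a * w a| ≤ ε * β := fun a => by
    obtain ⟨δ, hδ, hqa⟩ := hq a
    rw [hqa, show u a * w a * (1 + δ) - u a * w a = δ * (u a * w a) by ring, abs_mul]
    exact mul_le_mul hδ (hβ a) (abs_nonneg _) hε
  have hq2 : ∀ a, |q a| ≤ 2 * β := fun a => by
    have := abs_sub_abs_le_abs_sub (q a) (u a * w a)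
    have hβ0 : 0 ≤ β := (abs_nonneg _).trans (hβ a)
    nlinarith [hq1 a, hβ a]
  have hγ0 : 0 ≤ γ := le_trans (Multiset.sum_nonneg (by simp)) hγ
  have hβ0 : 0 ≤ Fintype.card l * β := by
    have : ∑ _a : l, (0 : ℝ) ≤ ∑ _a : l, β :=
      Finset.sum_le_sum fun a _ => (abs_nonneg _).trans (hβ a)
    simpa using this
  have hsumq : |∑ a, q a - ∑ a, u a * w a| ≤ ε * (Fintype.card l * β) := by
    rw [← Finset.sum_sub_distrib]
    refine (Finset.abs_sum_le_sum_abs _ _).trans ((Finset.sum_le_sum fun a _ => hq1 a).trans ?_)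
    simp only [Finset.sum_const, Finset.card_univ, nsmul_eq_mul]
    linarith
  have habsq : ∑ a, |q a| ≤ 2 * (Fintype.card l * β) := by
    refine (Finset.sum_le_sum fun a _ => hq2 a).trans ?_
    simp only [Finset.sum_const, Finset.card_univ, nsmul_eq_mul]
    linarith
  have hE1 : (Finset.univ.val.map q).sum = ∑ a, q a := rfl
  have hE2 : ((Finset.univ.val.map q).map abs).sum = ∑ a, |q a| := by
    rw [Multiset.map_map]; rfl
  rw [Multiset.sum_add, Multiset.map_add, Multiset.sum_add, hE1, hE2] at h1
  have hpow : (1 + ε) ^ (s + Finset.univ.val.map q).card - 1 ≤ 2 ^ (Fintype.card l + 1) * ε := by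
    -- `s` is empty for a plain product and holds the accumulated entry otherwise.
    have hcard : (s + Finset.univ.val.map q).card ≤ Fintype.card l + 1 := by
      rw [Multiset.card_add, Multiset.card_map, Finset.card_val, Finset.card_univ]; omega
    have h2 := pow_le_pow_right₀ (by linarith : 1 ≤ 1 + ε) hcard
    have h3 := one_add_pow_sub_one_le hε hε1 (Fintype.card l + 1)
    linarith
  have hM : 0 ≤ (s.map abs).sum + ∑ a, |q a| :=
    add_nonneg (Multiset.sum_nonneg (by simp)) (Finset.sum_nonneg fun _ _ => abs_nonneg _)
  have h4 : (s.map abs).sum + ∑ a, |q a| ≤ γ + 2 * (Fintype.card l * β) := add_le_add hγ habsq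
  have h5 := h1.trans (mul_le_mul hpow h4 hM (by positivity))
  have h6 : |d - (s.sum + ∑ a, u a * w a)| ≤ |d - (s.sum + ∑ a, q a)|
      + |∑ a, q a - ∑ a, u a * w a| := by
    refine le_trans (le_of_eq ?_) (abs_add_le _ _)
    congr 1; ring
  have h7 : (1 : ℝ) ≤ 2 ^ (Fintype.card l + 1) := one_le_pow₀ (by norm_num)
  have h8 : (2 : ℝ) ^ (Fintype.card l + 3) = 4 * 2 ^ (Fintype.card l + 1) := by ring
  rw [h8]
  nlinarith [mul_nonneg hε hγ0, mul_nonneg hε hβ0,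
    mul_nonneg (sub_nonneg.mpr h7) (mul_nonneg hε hγ0),
    mul_nonneg (sub_nonneg.mpr h7) (mul_nonneg hε hβ0)]

/-- A constant bounding the relative rounding errors of matrix products. -/
noncomputable def flConst (r l n : Type*) [Fintype r] [Fintype l] [Fintype n] : ℝ :=
  (Fintype.card r + 1) * (Fintype.card n + 1) *
    (2 ^ (Fintype.card l + 3) * (Fintype.card l + 1))

section

variable {r l n : Type*} [Fintype r] [Fintype l] [Fintype n]

theorem one_le_flConst : 1 ≤ flConst r l n := by
  have h1 : (1 : ℝ) ≤ Fintype.card r + 1 := by simp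
  have h2 : (1 : ℝ) ≤ Fintype.card n + 1 := by simp
  have h3 : (1 : ℝ) ≤ Fintype.card l + 1 := by simp
  have h4 : (1 : ℝ) ≤ 2 ^ (Fintype.card l + 3) := one_le_pow₀ (by norm_num)
  exact one_le_mul_of_one_le_of_one_le (one_le_mul_of_one_le_of_one_le h1 h2)
    (one_le_mul_of_one_le_of_one_le h4 h3)

theorem norm_le_flConst_mul [DecidableEq n] {E : Matrix r n ℝ} {ε y : ℝ} (hε : 0 ≤ ε) (hy : 0 ≤ y)
    (h : ∀ i j, |E i j| ≤ 2 ^ (Fintype.card l + 3) * ε * ((Fintype.card l + 1) * y)) :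
    ‖E‖ ≤ flConst r l n * ε * y := by
  refine (l2_opNorm_le_of_entry_le (by positivity) h).trans ?_
  have h0 : 0 ≤ 2 ^ (Fintype.card l + 3) * ε * ((Fintype.card l + 1) * y) := by positivity
  have h1 : (Fintype.card r : ℝ) * Fintype.card n ≤
      (Fintype.card r + 1) * (Fintype.card n + 1) := by gcongr <;> simp
  refine (mul_le_mul_of_nonneg_right h1 h0).trans (le_of_eq ?_)
  rw [flConst]; ring

variable [DecidableEq l] [DecidableEq n]

theorem FlMul.norm_sub_le {ε : ℝ} (hε : 0 ≤ ε) (hε1 : ε ≤ 1) {A : Matrix r l ℝ}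
    {B : Matrix l n ℝ} {D : Matrix r n ℝ} (h : FlMul ε A B D) :
    ‖D - A * B‖ ≤ flConst r l n * ε * (‖A‖ * ‖B‖) := by
  refine norm_le_flConst_mul hε (by positivity) fun i j => ?_
  obtain ⟨q, hq, hD⟩ := h i j
  have := abs_flSum_products_le hε hε1 hq (s := 0) (β := ‖A‖ * ‖B‖) (γ := 0) (d := D i j)
    (fun a => by
      rw [abs_mul]
      exact mul_le_mul (abs_entry_le_l2_opNorm A i a) (abs_entry_le_l2_opNorm B a j)
        (abs_nonneg _) (norm_nonneg _)) (by simp) (by simp) (by simpa using hD)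
  rw [Matrix.sub_apply, Matrix.mul_apply]
  rw [Multiset.sum_zero, zero_add, zero_add] at this
  refine this.trans ?_
  have : 0 ≤ ‖A‖ * ‖B‖ := by positivity
  gcongr
  simp

theorem FlAddMul.norm_sub_le {ε : ℝ} (hε : 0 ≤ ε) (hε1 : ε ≤ 1) {C : Matrix r n ℝ}
    {A : Matrix r l ℝ} {B : Matrix l n ℝ} {D : Matrix r n ℝ} (h : FlAddMul ε C A B D) :
    ‖D - (C + A * B)‖ ≤ flConst r l n * ε * (‖C‖ + ‖A‖ * ‖B‖) := by
  refine norm_le_flConst_mul hε (by positivity) fun i j => ?_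
  obtain ⟨q, hq, hD⟩ := h i j
  have := abs_flSum_products_le hε hε1 hq (s := {C i j}) (β := ‖A‖ * ‖B‖) (γ := ‖C‖) (d := D i j)
    (fun a => by
      rw [abs_mul]
      exact mul_le_mul (abs_entry_le_l2_opNorm A i a) (abs_entry_le_l2_opNorm B a j)
        (abs_nonneg _) (norm_nonneg _)) (by simpa using abs_entry_le_l2_opNorm C i j) (by simp)
    (by simpa using hD)
  rw [Matrix.sub_apply, Matrix.add_apply, Matrix.mul_apply]
  rw [Multiset.sum_singleton] at this
  refine this.trans ?_
  have h1 : 0 ≤ ‖A‖ * ‖B‖ := by positivity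
  have h2 : ‖C‖ + Fintype.card l * (‖A‖ * ‖B‖) ≤ (Fintype.card l + 1) * (‖C‖ + ‖A‖ * ‖B‖) := by
    nlinarith [mul_nonneg (Nat.cast_nonneg (α := ℝ) (Fintype.card l)) (norm_nonneg C)]
  gcongr

end

/-! ### Error analysis of a single projection, intraorthogonalization and residual. -/

section Step

variable {r l n : Type*} [Fintype r] [Fintype l] [Fintype n]
  [DecidableEq l] [DecidableEq n]

theorem norm_mul_le_of_le {A : Matrix r l ℝ} {B : Matrix l n ℝ} {α β : ℝ} (hA : ‖A‖ ≤ α)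
    (hB : ‖B‖ ≤ β) : ‖A * B‖ ≤ α * β :=
  (l2_opNorm_mul A B).trans (mul_le_mul hA hB (norm_nonneg _) ((norm_nonneg _).trans hA))

/-- One rounded projection `V ≈ Y - Q (Qᵀ Y)` against a nearly orthonormal `Q`. -/
theorem rounded_projection [DecidableEq r] {Q : Matrix r l ℝ} {Y V : Matrix r n ℝ} {S : Matrix l n ℝ}
    {a C ε y : ℝ} (ha : 1 ≤ a) (hε : 0 ≤ ε) (hε1 : ε ≤ 1) (hCε : C * ε ≤ 1) (hy : 0 ≤ y)
    (hQ : ‖1 - Qᵀ * Q‖ ≤ C * ε) (hY : ‖Y‖ ≤ y)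
    (hS : ‖S - Qᵀ * Y‖ ≤ a * ε * (‖Qᵀ‖ * ‖Y‖))
    (hV : ‖V - (Y + -Q * S)‖ ≤ a * ε * (‖Y‖ + ‖-Q‖ * ‖S‖)) :
    ‖S‖ ≤ (2 + 2 * a) * y ∧
    ‖V - (Y - Q * S)‖ ≤ (9 * a + 4 * a ^ 2) * ε * y ∧
    ‖V - (Y - Q * (Qᵀ * Y))‖ ≤ (9 * a + 4 * a ^ 2) * ε * y ∧
    ‖V‖ ≤ (1 + (9 * a + 4 * a ^ 2) * ε) * y ∧
    ‖Qᵀ * V‖ ≤ C * ε * ‖Qᵀ * Y‖ + 2 * (9 * a + 4 * a ^ 2) * ε * y := by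
  have hQ2 : ‖Q‖ ≤ 2 := (norm_le_of_orthogonality hQ).trans (by linarith)
  have hQt : ‖Qᵀ‖ ≤ 2 := by rwa [l2_opNorm_transpose]
  have haε : 0 ≤ a * ε := by positivity
  have h1 : ‖S - Qᵀ * Y‖ ≤ a * ε * (2 * y) := hS.trans (by gcongr)
  have hQY : ‖Qᵀ * Y‖ ≤ 2 * y := norm_mul_le_of_le hQt hY
  have h2 : ‖S‖ ≤ (2 + 2 * a) * y := by
    have := norm_add_le (S - Qᵀ * Y) (Qᵀ * Y)
    rw [sub_add_cancel] at this
    nlinarith [mul_nonneg (sub_nonneg.mpr hε1) (mul_nonneg (by linarith : 0 ≤ a) hy)]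
  have h3 : ‖V - (Y - Q * S)‖ ≤ a * ε * (y + 2 * ((2 + 2 * a) * y)) := by
    have hneg : Y - Q * S = Y + -Q * S := by rw [Matrix.neg_mul, sub_eq_add_neg]
    rw [hneg]
    refine hV.trans ?_
    rw [norm_neg]
    gcongr
  -- The rounding of V costs (5a + 4a²)εy and that of S, multiplied by ‖Q‖ ≤ 2, another 4aεy; hence
  -- 9a + 4a².
  have h4 : ‖V - (Y - Q * (Qᵀ * Y))‖ ≤ (9 * a + 4 * a ^ 2) * ε * y := by
    have hdec : V - (Y - Q * (Qᵀ * Y)) = (V - (Y - Q * S)) - Q * (S - Qᵀ * Y) := by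
      rw [Matrix.mul_sub]; abel
    rw [hdec]
    have := norm_sub_le (V - (Y - Q * S)) (Q * (S - Qᵀ * Y))
    have h5 := norm_mul_le_of_le hQ2 h1
    linarith
  refine ⟨h2, h3.trans ?_, h4, ?_, ?_⟩
  · nlinarith [mul_nonneg haε hy]
  · have h5 := norm_sub_mul_transpose_mul_le (hQ.trans hCε) Y
    have h6 := norm_add_le (V - (Y - Q * (Qᵀ * Y))) (Y - Q * (Qᵀ * Y))
    rw [sub_add_cancel] at h6
    linarith
  -- Exact projection leaves only (I - QᵀQ)QᵀY along Q, which is already of order ε.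
  · have hdec : Qᵀ * V = (1 - Qᵀ * Q) * (Qᵀ * Y) + Qᵀ * (V - (Y - Q * (Qᵀ * Y))) := by
      simp only [Matrix.mul_sub, Matrix.sub_mul, Matrix.one_mul, Matrix.mul_assoc]
      abel
    rw [hdec]
    refine (norm_add_le _ _).trans (add_le_add (norm_mul_le_of_le hQ le_rfl) ?_)
    refine (norm_mul_le_of_le hQt h4).trans (le_of_eq (by ring))

/-- The first projection does not reduce the smallest singular value by much. -/
theorem boundedBelow_projection {Q X₀ : Matrix r l ℝ} {R₀ : Matrix l l ℝ} {X₁ V : Matrix r n ℝ}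
    {S : Matrix l n ℝ} {b C ε ω x σ : ℝ} (hb : 0 ≤ b) (hC : 0 ≤ C) (hσ : 0 < σ)
    (hx : ε * x ≤ ω * σ) (hω : (C + b) * ω ≤ 1 / 2) (hω0 : 0 ≤ ω)
    (hX : ∀ y v, σ * euclNorm y ≤ euclNorm (X₀ *ᵥ y + X₁ *ᵥ v) ∧
      σ * euclNorm v ≤ euclNorm (X₀ *ᵥ y + X₁ *ᵥ v))
    (hR : ‖X₀ - Q * R₀‖ ≤ C * ε * x) (hV : ‖V - (X₁ - Q * S)‖ ≤ b * ε * x) :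
    BoundedBelow V ((1 - (C + b) * ω) * σ) := by
  have hCω : C * ω ≤ 1 / 2 := by nlinarith [mul_nonneg hb hω0]
  have hR' : ‖X₀ - Q * R₀‖ ≤ C * ω * σ := by nlinarith
  have hV' : ‖V - (X₁ - Q * S)‖ ≤ b * ω * σ := by nlinarith
  have hX₀ : BoundedBelow X₀ σ := fun y => by simpa using (hX y 0).1
  have hQR : BoundedBelow (Q * R₀) (σ / 2) :=
    (hX₀.perturb (e := C * ω * σ) (by rw [norm_sub_rev]; exact hR')).mono (by nlinarith)
  -- Only positivity of the lower bound matters here, to make R₀ onto; its size never enters the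
  -- estimate.
  have hR₀ := hQR.of_mul_left (a := ‖Q‖ + 1) (by positivity) (by linarith)
  intro v
  -- This y makes QR₀y cancel QSv, so Vv is the combination X₀(-y) + X₁v up to residuals. By `hX`
  -- the errors in both y and v are small relative to that same combination.
  obtain ⟨y, hy : R₀ *ᵥ y = S *ᵥ v⟩ := hR₀.mulVec_surjective (by positivity) (S *ᵥ v)
  have hdec : V *ᵥ v = (X₀ *ᵥ (-y) + X₁ *ᵥ v)
      - ((X₀ - Q * R₀) *ᵥ (-y) - (V - (X₁ - Q * S)) *ᵥ v) := by
    simp only [Matrix.sub_mulVec, Matrix.mulVec_neg, ← Matrix.mulVec_mulVec, hy]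
    abel
  have h1 := euclNorm_sub_le (X₀ *ᵥ (-y) + X₁ *ᵥ v)
    ((X₀ - Q * R₀) *ᵥ (-y) - (V - (X₁ - Q * S)) *ᵥ v)
  rw [← hdec] at h1
  have h2 : euclNorm ((X₀ - Q * R₀) *ᵥ (-y) - (V - (X₁ - Q * S)) *ᵥ v)
      ≤ euclNorm ((X₀ - Q * R₀) *ᵥ (-y)) + euclNorm ((V - (X₁ - Q * S)) *ᵥ v) := by
    simpa [euclNorm] using norm_sub_le (WithLp.toLp 2 ((X₀ - Q * R₀) *ᵥ (-y)))
      (WithLp.toLp 2 ((V - (X₁ - Q * S)) *ᵥ v))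
  have h3 := euclNorm_mulVec_le (X₀ - Q * R₀) (-y)
  have h4 := euclNorm_mulVec_le (V - (X₁ - Q * S)) v
  obtain ⟨h5, h6⟩ := hX (-y) v
  have h7 := mul_le_mul_of_nonneg_right hR' (euclNorm_nonneg (-y))
  have h8 := mul_le_mul_of_nonneg_right hV' (euclNorm_nonneg v)
  have h9 := mul_le_mul_of_nonneg_left h5 (mul_nonneg hC hω0)
  have h10 := mul_le_mul_of_nonneg_left h6 (mul_nonneg hb hω0)
  have h11 := mul_le_mul_of_nonneg_left h6 (by linarith : 0 ≤ 1 - (C + b) * ω)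
  linarith

/-- The effect of an intraorthogonalization `U S = V + ΔV` on the angle to `Q`. -/
theorem intraortho_step [DecidableEq r] {Q : Matrix r l ℝ} {U V ΔV : Matrix r n ℝ} {S : Matrix n n ℝ}
    {c ε x σ h : ℝ} (hc : 0 ≤ c) (hε : 0 ≤ ε) (hσ : 0 < σ) (hσx : σ ≤ x)
    (hcε : 8 * c * (ε * x) ≤ σ)
    (hQ2 : ‖Q‖ ≤ 2) (hUS : V + ΔV = U * S) (hΔ : ‖ΔV‖ ≤ c * ε * ‖V‖) (hU : ‖1 - Uᵀ * U‖ ≤ 1 / 2)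
    (hV : ‖V‖ ≤ 2 * x) (hV' : BoundedBelow V (σ / 2)) (hQV : ‖Qᵀ * V‖ ≤ h * ε * x) :
    ‖Qᵀ * U‖ ≤ 8 * (h + 4 * c) * (ε * x / σ) ∧ ‖S‖ ≤ 5 * x ∧ ‖U‖ ≤ 2 ∧
      ‖ΔV‖ ≤ 2 * c * ε * x := by
  have hx : 0 < x := hσ.trans_le hσx
  have hcε0 : 0 ≤ c * ε := mul_nonneg hc hε
  have hΔ' : ‖ΔV‖ ≤ 2 * c * ε * x := by nlinarith
  have hU2 : ‖U‖ ≤ 2 := (norm_le_of_orthogonality hU).trans (by norm_num)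
  have hQt : ‖Qᵀ‖ ≤ 2 := by rwa [l2_opNorm_transpose]
  have hUb : BoundedBelow U (1 / 2) :=
    (BoundedBelow.of_orthogonality hU (by norm_num)).mono (by norm_num)
  have hUSb : BoundedBelow (U * S) (σ / 4) :=
    (hV'.perturb (e := σ / 4) (by rw [← hUS, add_sub_cancel_left]; linarith)).mono (by linarith)
  have hSb : BoundedBelow S (σ / 8) :=
    (hUSb.of_mul_left (a := 2) (by norm_num) hU2).mono (by linarith)
  refine ⟨?_, ?_, hU2, hΔ'⟩
  -- QᵀUS = QᵀV + QᵀΔV is O(εx); cancelling S costs the factor 8/σ.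
  · have h1 : ‖Qᵀ * U * S‖ ≤ (h + 4 * c) * (ε * x) := by
      rw [Matrix.mul_assoc, ← hUS, Matrix.mul_add]
      refine (norm_add_le _ _).trans ((add_le_add hQV (norm_mul_le_of_le hQt hΔ')).trans ?_)
      linarith
    refine (hSb.norm_left_le (by positivity) h1).trans (le_of_eq ?_)
    field_simp
  · have h1 : ‖U * S‖ ≤ 5 / 2 * x := by
      rw [← hUS]
      refine (norm_add_le _ _).trans ?_
      linarith
    refine (hUb.norm_right_le (by norm_num) h1).trans (le_of_eq ?_)
    ring

/-- The residual of one block column. -/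
theorem residual_step {Q : Matrix r l ℝ} {X₁ V U H Q₁ ΔV ΔH : Matrix r n ℝ}
    {S T R₁ : Matrix l n ℝ} {S' T' R' : Matrix n n ℝ} {a b c ε x : ℝ} (ha : 1 ≤ a) (hε : 0 ≤ ε)
    (hQ2 : ‖Q‖ ≤ 2) (hQ₁2 : ‖Q₁‖ ≤ 2) (hUS : V + ΔV = U * S') (hHT : H + ΔH = Q₁ * T')
    (hV : ‖V - (X₁ - Q * S)‖ ≤ b * ε * x) (hH : ‖H - (U - Q * T)‖ ≤ b * ε * 2)
    (hΔV : ‖ΔV‖ ≤ 2 * c * ε * x) (hΔH : ‖ΔH‖ ≤ 2 * c * ε)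
    (hS : ‖S‖ ≤ (2 + 2 * a) * x) (hT : ‖T‖ ≤ (2 + 2 * a) * 2) (hS' : ‖S'‖ ≤ 5 * x)
    (hT' : ‖T'‖ ≤ 5)
    (hR₁ : ‖R₁ - (S + T * S')‖ ≤ a * ε * (‖S‖ + ‖T‖ * ‖S'‖))
    (hR' : ‖R' - T' * S'‖ ≤ a * ε * (‖T'‖ * ‖S'‖)) :
    ‖X₁ - (Q * R₁ + Q₁ * R')‖ ≤ (11 * b + 12 * c + 22 * a * (2 + 2 * a) + 50 * a) * ε * x := by
  have haε : 0 ≤ a * ε := by positivity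
  -- Eliminating US' = V + ΔV and Q₁T' = H + ΔH leaves only local errors. Those committed after the
  -- first intraorthogonalization are multiplied by S', of size 5x, which accounts for 11b = b +
  -- 2·5b and 12c = 2c + 2·5c.
  have hdec : X₁ - (Q * R₁ + Q₁ * R') = -(V - (X₁ - Q * S)) - ΔV - (H - (U - Q * T)) * S'
      - ΔH * S' - Q * (R₁ - (S + T * S')) - Q₁ * (R' - T' * S') := by
    have h1 : ΔV = U * S' - V := by rw [← hUS]; abel
    have h2 : ΔH = Q₁ * T' - H := by rw [← hHT]; abel
    rw [h1, h2]
    simp only [Matrix.mul_sub, Matrix.sub_mul, Matrix.mul_add, Matrix.mul_assoc]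
    abel
  have e1 : ‖R₁ - (S + T * S')‖ ≤ a * ε * ((2 + 2 * a) * x + (2 + 2 * a) * 2 * (5 * x)) :=
    hR₁.trans (by gcongr)
  have e2 : ‖R' - T' * S'‖ ≤ a * ε * (5 * (5 * x)) := hR'.trans (by gcongr)
  have e3 := norm_mul_le_of_le hQ2 e1
  have e4 := norm_mul_le_of_le hQ₁2 e2
  have e5 := norm_mul_le_of_le hH hS'
  have e6 := norm_mul_le_of_le hΔH hS'
  rw [hdec]
  refine (norm_sub_le _ _).trans ?_
  refine (add_le_add_left (norm_sub_le _ _) _).trans ?_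
  refine (add_le_add_left (add_le_add_left (norm_sub_le _ _) _) _).trans ?_
  refine (add_le_add_left (add_le_add_left (add_le_add_left (norm_sub_le _ _) _) _) _).trans ?_
  refine (add_le_add_left (add_le_add_left (add_le_add_left (add_le_add_left
    (norm_sub_le _ _) _) _) _) _).trans ?_
  rw [norm_neg]
  linarith

end Step

/-! ### Condition numbers after a small perturbation. -/

section Kappa

variable {r n : Type*} [Fintype r] [Fintype n] [DecidableEq n]

/-- The condition on β is (1 + β)/(1 - β) ≤ τ with the denominator cleared. -/
theorem kappa_le_mul_of_perturb [Nonempty n] {A : Matrix r n ℝ} {β τ x σ : ℝ} (hβ : β * (1 + τ) ≤ τ - 1)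
    (hβ1 : β < 1) (hx : 0 ≤ x) (hσ : 0 < σ) (hA : ‖A‖ ≤ (1 + β) * x)
    (hA' : BoundedBelow A ((1 - β) * σ)) : kappa A ≤ ENNReal.ofReal (τ * (x / σ)) := by
  have h1 : 0 < 1 - β := by linarith
  refine (hA'.kappa_le (mul_pos h1 hσ) hA).trans (ENNReal.ofReal_le_ofReal ?_)
  rw [div_le_iff₀ (mul_pos h1 hσ)]
  have : τ * (x / σ) * ((1 - β) * σ) = τ * (1 - β) * x := by field_simp
  rw [this]
  exact mul_le_mul_of_nonneg_right (by linarith) hx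

/-- As κ ≥ 1, raising the exponent only weakens the bound; a nonnegative β makes the power monotone
in κ, so negative α is covered too. -/
theorem kappa_rpow_le {A : Matrix r n ℝ} {t α β : ℝ} (hαβ : α ≤ β) (hβ : 0 ≤ β) (ht : 0 ≤ t)
    (h : kappa A ≤ ENNReal.ofReal t) : kappa A ^ α ≤ ENNReal.ofReal (t ^ β) := by
  rw [← ENNReal.ofReal_rpow_of_nonneg ht hβ]
  exact (ENNReal.rpow_le_rpow_of_exponent_le (one_le_kappa A) hαβ).trans
    (ENNReal.rpow_le_rpow h hβ)

end Kappa

/-! ### The induction step: one block column. -/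

set_option maxHeartbeats 400000 in
/-- Orthogonality and residual of one block column computed by BCGSI+A, given those of the
preceding ones. -/
theorem exists_block_step_bound {m s : ℕ} (l : Type*) [Fintype l] [DecidableEq l]
    (hs : 0 < s) (α₁ α₂ : ℝ) {c τ C : ℝ} (hc : 0 < c) (hτ : 1 < τ) (hC : 0 < C) :
    ∃ K C' : ℝ, 0 < K ∧ 0 < C' ∧ ∀ (ε x σ : ℝ), 0 < ε → 0 < σ → σ ≤ x →
      K * (ε * (x / σ) ^ max α₁ 1) ≤ 1 →
      ∀ (IO1 IO2 : IntraOrtho m s), IO1.Stable c ε α₁ (ENNReal.ofReal (τ * (x / σ))) →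
      IO2.Stable c ε α₂ (ENNReal.ofReal (τ * (x / σ))) →
      ∀ (Q X₀ : Matrix (Fin m) l ℝ) (R₀ : Matrix l l ℝ) (X₁ V U H Q₁ : Matrix (Fin m) (Fin s) ℝ)
        (S T R₁ : Matrix l (Fin s) ℝ) (S' T' R' : Matrix (Fin s) (Fin s) ℝ),
      (∀ y v, σ * euclNorm y ≤ euclNorm (X₀ *ᵥ y + X₁ *ᵥ v) ∧
        σ * euclNorm v ≤ euclNorm (X₀ *ᵥ y + X₁ *ᵥ v)) →
      ‖X₁‖ ≤ x → ‖1 - Qᵀ * Q‖ ≤ C * ε → ‖X₀ - Q * R₀‖ ≤ C * ε * x →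
      FlMul ε Qᵀ X₁ S → FlAddMul ε X₁ (-Q) S V → (U, S') = IO1 V →
      FlMul ε Qᵀ U T → FlAddMul ε U (-Q) T H → (Q₁, T') = IO2 H →
      FlAddMul ε S T S' R₁ → FlMul ε T' S' R' →
      ‖Qᵀ * Q₁‖ ≤ C' * ε ∧ ‖1 - Q₁ᵀ * Q₁‖ ≤ C' * ε ∧
        ‖X₁ - (Q * R₁ + Q₁ * R')‖ ≤ C' * ε * x := by
  have : Nonempty (Fin s) := ⟨⟨0, hs⟩⟩
  set θ := max α₁ 1 with hθ
  have hθ1 : 1 ≤ θ := le_max_right _ _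
  obtain ⟨a, ha1, haA, haB, haC, haD⟩ : ∃ a : ℝ, 1 ≤ a ∧ flConst l (Fin m) (Fin s) ≤ a ∧
      flConst (Fin m) l (Fin s) ≤ a ∧ flConst l (Fin s) (Fin s) ≤ a ∧
      flConst (Fin s) (Fin s) (Fin s) ≤ a := by
    have h1 := one_le_flConst (r := l) (l := Fin m) (n := Fin s)
    have h2 := one_le_flConst (r := Fin m) (l := l) (n := Fin s)
    have h3 := one_le_flConst (r := l) (l := Fin s) (n := Fin s)
    have h4 := one_le_flConst (r := Fin s) (l := Fin s) (n := Fin s)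
    exact ⟨flConst l (Fin m) (Fin s) + flConst (Fin m) l (Fin s) + flConst l (Fin s) (Fin s) +
      flConst (Fin s) (Fin s) (Fin s), by linarith, by linarith, by linarith, by linarith,
      by linarith⟩
  obtain ⟨b, hb⟩ : ∃ b, b = 9 * a + 4 * a ^ 2 := ⟨_, rfl⟩
  -- In units of ω, d bounds the loss of orthogonality in U, f bounds QᵀU, and e bounds the
  -- deviation of H from orthonormality. In units of ε, g and f' bound the loss in Q₁ and QᵀQ₁. W
  -- dominates every coefficient that must be small after multiplication by ω.
  obtain ⟨f, hf⟩ : ∃ f, f = 8 * ((2 * C + 2 * b) + 4 * c) := ⟨_, rfl⟩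
  obtain ⟨d, hd⟩ : ∃ d, d = c * τ ^ θ := ⟨_, rfl⟩
  obtain ⟨e, he⟩ : ∃ e, e = d + 2 * f + 2 * b := ⟨_, rfl⟩
  obtain ⟨g, hg⟩ : ∃ g, g = c * τ ^ max α₂ 0 := ⟨_, rfl⟩
  obtain ⟨f', hf'⟩ : ∃ f', f' = 8 * ((4 * C + 4 * b) + 4 * c) := ⟨_, rfl⟩
  obtain ⟨ρ, hρ⟩ : ∃ ρ, ρ = 11 * b + 12 * c + 22 * a * (2 + 2 * a) + 50 * a := ⟨_, rfl⟩
  obtain ⟨W, hW⟩ : ∃ W, W = 1 + C + b + 8 * c + e + g := ⟨_, rfl⟩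
  have hτ0 : 0 < τ := by linarith
  have hτ1 : 0 < τ - 1 := by linarith
  have hb0 : 0 < b := by rw [hb]; positivity
  have hd0 : 0 < d := by rw [hd]; positivity
  have hf0 : 0 < f := by rw [hf]; positivity
  have he0 : 0 < e := by rw [he]; positivity
  have hg0 : 0 < g := by rw [hg]; positivity
  have hf'0 : 0 < f' := by rw [hf']; positivity
  have hρ0 : 0 < ρ := by rw [hρ]; positivity
  have hW0 : 0 < W := by rw [hW]; positivity
  -- The two summands of K yield 2Wω ≤ 1 and Wω(1 + τ) ≤ τ - 1, the latter being the hypothesis of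
  -- `kappa_le_mul_of_perturb`.
  refine ⟨2 * W + W * (1 + τ) / (τ - 1), f' + g + ρ, by positivity, by positivity, ?_⟩
  intro ε x σ hε hσ hσx hK IO1 IO2 hIO1 hIO2 Q X₀ R₀ X₁ V U H Q₁ S T R₁ S' T' R' hX hX₁ hQ hR₀
    hS hV hU hT hH hQ₁ hR₁ hR'
  have hx : 0 < x := hσ.trans_le hσx
  have hκ : 1 ≤ x / σ := (one_le_div hσ).mpr hσx
  obtain ⟨ω, hω⟩ : ∃ ω, ω = ε * (x / σ) ^ θ := ⟨_, rfl⟩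
  rw [← hω] at hK
  have hεω : ε ≤ ω := by
    rw [hω]; exact le_mul_of_one_le_right hε.le (Real.one_le_rpow hκ (by linarith))
  have hω0 : 0 < ω := hε.trans_le hεω
  -- εκ ≤ ω uses θ ≥ 1.
  have hκω : ε * x / σ ≤ ω := by
    rw [hω, mul_div_assoc]
    gcongr
    simpa using Real.rpow_le_rpow_of_exponent_le hκ hθ1
  have hxω : ε * x ≤ ω * σ := (div_le_iff₀ hσ).mp hκω
  have hWω1 : 2 * W * ω ≤ 1 := by
    have : 0 ≤ W * (1 + τ) / (τ - 1) * ω := by positivity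
    linarith
  have hWω2 : W * ω * (1 + τ) ≤ τ - 1 := by
    have h1 : W * (1 + τ) / (τ - 1) * ω ≤ 1 := by
      have : 0 ≤ 2 * W * ω := by positivity
      linarith
    rw [div_mul_eq_mul_div, div_le_one hτ1] at h1
    linarith
  have hp : ∀ {t : ℝ}, t ≤ W → t * ω ≤ 1 / 2 ∧ t * ω * (1 + τ) ≤ τ - 1 := fun {t} ht => by
    have h1 := mul_le_mul_of_nonneg_right ht hω0.le
    exact ⟨by linarith, le_trans (by gcongr) hWω2⟩
  have hCb := hp (t := C + b) (by linarith)
  have hC1 := (hp (t := C) (by linarith)).1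
  have hc8 := (hp (t := 8 * c) (by linarith)).1
  have hdω := (hp (t := d) (by linarith)).1
  have heω := hp (t := e) (by linarith)
  have hgω := (hp (t := g) (by linarith)).1
  have h1ω := (hp (t := 1) (by linarith)).1
  have hε1 : ε ≤ 1 := by linarith
  have hCε : C * ε ≤ 1 := (mul_le_mul_of_nonneg_left hεω hC.le).trans (by linarith)
  have hQ2 : ‖Q‖ ≤ 2 := (norm_le_of_orthogonality hQ).trans (by linarith)
  have hQt : ‖Qᵀ‖ ≤ 2 := by rwa [l2_opNorm_transpose]
  have mono : ∀ {t y z : ℝ}, t ≤ a → 0 ≤ y → z ≤ t * ε * y → z ≤ a * ε * y :=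
    fun ht hy hz => hz.trans (by gcongr)
  -- first projection and intraorthogonalization
  obtain ⟨hS2, hV1, -, hV3, hV4⟩ := rounded_projection ha1 hε.le hε1 hCε hx.le hQ hX₁
    (mono haA (by positivity) (hS.norm_sub_le hε.le hε1))
    (mono haB (by positivity) (hV.norm_sub_le hε.le hε1))
  rw [← hb] at hV1 hV3 hV4
  have hVb := boundedBelow_projection hb0.le hC.le hσ hxω hCb.1 hω0.le hX hR₀ hV1
  have hbε : b * ε ≤ (C + b) * ω := mul_le_mul (by linarith) hεω hε.le (by linarith)
  have hV5 : ‖V‖ ≤ (1 + (C + b) * ω) * x := hV3.trans (by gcongr)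
  have hκV := kappa_le_mul_of_perturb hCb.2 (by linarith) hx.le hσ hV5 hVb
  obtain ⟨⟨ΔV, hΔV, hΔV2⟩, hUo⟩ := hIO1 V hκV
  rw [← hU] at hΔV hUo
  have hUo1 : ‖1 - Uᵀ * U‖ ≤ d * ω := by
    have h1 := kappa_rpow_le (le_max_left α₁ 1) (by linarith) (by positivity) hκV
    have h2 := hUo.trans (mul_le_mul' le_rfl h1)
    rw [← ENNReal.ofReal_mul (by positivity), ENNReal.ofReal_le_ofReal_iff (by positivity),
      Real.mul_rpow hτ0.le (by positivity)] at h2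
    rw [hd, hω]
    linarith
  have hQX : ‖Qᵀ * X₁‖ ≤ 2 * x := norm_mul_le_of_le hQt hX₁
  have hQV : ‖Qᵀ * V‖ ≤ (2 * C + 2 * b) * ε * x := by
    have := mul_le_mul_of_nonneg_left hQX (by positivity : 0 ≤ C * ε)
    linarith
  have hV6 : ‖V‖ ≤ 2 * x := hV5.trans (by gcongr; linarith)
  have hcσ : 8 * c * (ε * x) ≤ σ := by
    have h1 := mul_le_mul_of_nonneg_left hxω (by positivity : 0 ≤ 8 * c)
    have h2 := mul_le_mul_of_nonneg_right hc8 hσ.le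
    linarith
  have hσ2 : σ / 2 ≤ (1 - (C + b) * ω) * σ := by
    have := mul_le_mul_of_nonneg_right hCb.1 hσ.le
    linarith
  obtain ⟨hQU, hS'5, hU2, hΔV3⟩ := intraortho_step hc.le hε.le hσ hσx
    hcσ hQ2 hΔV hΔV2 (hUo1.trans hdω) hV6 (hVb.mono hσ2) hQV
  rw [← hf] at hQU
  have hQUω : ‖Qᵀ * U‖ ≤ f * ω := hQU.trans (by gcongr)
  -- second projection and intraorthogonalization
  obtain ⟨hT2, hH1, hH2, -, hH4⟩ := rounded_projection ha1 hε.le hε1 hCε zero_le_two hQ hU2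
    (mono haA (by positivity) (hT.norm_sub_le hε.le hε1))
    (mono haB (by positivity) (hH.norm_sub_le hε.le hε1))
  rw [← hb] at hH1 hH2 hH4
  -- U is already orthogonal to Q up to O(ω), so the second projection hardly changes it.
  have hHU : ‖H - U‖ ≤ (2 * f + 2 * b) * ω := by
    have hdec : H - U = (H - (U - Q * (Qᵀ * U))) - Q * (Qᵀ * U) := by abel
    rw [hdec]
    refine (norm_sub_le _ _).trans ((add_le_add hH2 (norm_mul_le_of_le hQ2 hQUω)).trans ?_)
    have := mul_le_mul_of_nonneg_left hεω hb0.le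
    linarith
  have hH5 : ‖H‖ ≤ (1 + e * ω) * 1 := by
    have h1 := norm_le_of_orthogonality hUo1
    have h2 := norm_add_le (H - U) U
    rw [sub_add_cancel] at h2
    rw [he]
    linarith
  have hHb : BoundedBelow H ((1 - e * ω) * 1) :=
    ((BoundedBelow.of_orthogonality hUo1 (by linarith)).perturb hHU).mono (by rw [he]; linarith)
  -- With x = σ = 1 the bound is κ(H) ≤ τ, free of κ(X); α₂ therefore enters only the constant g.
  have hκH := kappa_le_mul_of_perturb heω.2 (by linarith) zero_le_one one_pos hH5 hHb
  rw [div_one, mul_one] at hκH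
  obtain ⟨⟨ΔH, hΔH, hΔH2⟩, hQ₁o⟩ := hIO2 H (hκH.trans (ENNReal.ofReal_le_ofReal
    (le_mul_of_one_le_right hτ0.le hκ)))
  rw [← hQ₁] at hΔH hQ₁o
  have hQ₁o1 : ‖1 - Q₁ᵀ * Q₁‖ ≤ g * ε := by
    have h1 := kappa_rpow_le (le_max_left α₂ 0) (le_max_right _ _) hτ0.le hκH
    have h2 := hQ₁o.trans (mul_le_mul' le_rfl h1)
    rw [← ENNReal.ofReal_mul (by positivity), ENNReal.ofReal_le_ofReal_iff (by positivity)] at h2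
    rw [hg]
    linarith
  have hQU4 : ‖Qᵀ * U‖ ≤ 4 := (norm_mul_le_of_le hQt hU2).trans (by norm_num)
  have hQH : ‖Qᵀ * H‖ ≤ (4 * C + 4 * b) * ε * 1 := by
    have := mul_le_mul_of_nonneg_left hQU4 (by positivity : 0 ≤ C * ε)
    linarith
  have hcε : 8 * c * (ε * 1) ≤ 1 := by
    have := mul_le_mul_of_nonneg_left hεω (by positivity : 0 ≤ 8 * c)
    linarith
  have hgε : g * ε ≤ 1 / 2 := (mul_le_mul_of_nonneg_left hεω hg0.le).trans hgω
  -- The same estimate with x = σ = 1: no factor κ appears, so QᵀQ₁ is O(ε).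
  obtain ⟨hQQ₁, hT'5, hQ₁2, hΔH3⟩ := intraortho_step hc.le hε.le one_pos le_rfl
    hcε hQ2 hΔH hΔH2 (hQ₁o1.trans hgε)
    (hH5.trans (by linarith)) (hHb.mono (by linarith)) hQH
  rw [← hf', mul_one, div_one] at hQQ₁
  rw [mul_one] at hT'5 hΔH3
  have hres := residual_step ha1 hε.le hQ2 hQ₁2 hΔV hΔH hV1 hH1 hΔV3 hΔH3 hS2 hT2 hS'5 hT'5
    (mono haC (by positivity) (hR₁.norm_sub_le hε.le hε1))
    (mono haD (by positivity) (hR'.norm_sub_le hε.le hε1))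
  rw [← hρ] at hres
  exact ⟨hQQ₁.trans (mul_le_mul_of_nonneg_right (by linarith) hε.le),
    hQ₁o1.trans (mul_le_mul_of_nonneg_right (by linarith) hε.le),
    hres.trans (mul_le_mul_of_nonneg_right (mul_le_mul_of_nonneg_right (by linarith) hε.le) hx.le)⟩

/-! ### Leading blocks of Gram matrices and of products. -/

theorem one_sub_gram_submatrix_apply {r l n : Type*} [Fintype r] [DecidableEq l] [DecidableEq n]
    (A : Matrix r n ℝ) {f : l → n} (hf : Function.Injective f) (i j : l) :
    ((1 : Matrix l l ℝ) - (A.submatrix id f)ᵀ * A.submatrix id f) i j =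
      ((1 : Matrix n n ℝ) - Aᵀ * A) (f i) (f j) := by
  simp [Matrix.one_apply, hf.eq_iff, Matrix.mul_apply]

theorem one_sub_gram_apply_comm {r n : Type*} [Fintype r] [DecidableEq n] (A : Matrix r n ℝ)
    (i j : n) : ((1 : Matrix n n ℝ) - Aᵀ * A) i j = ((1 : Matrix n n ℝ) - Aᵀ * A) j i := by
  simp [Matrix.one_apply, Matrix.mul_apply, eq_comm, mul_comm]

section Blocks

variable {m p s : ℕ}

/-- The columns of the blocks before block `k`, as columns of the full matrix. -/
def prevIdx (p s : ℕ) (k : Fin p) (a : {j : Fin p // j < k} × Fin s) : Fin p × Fin s :=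
  (a.1.val, a.2)

theorem prevIdx_injective (k : Fin p) : Function.Injective (prevIdx p s k) := by
  rintro ⟨⟨a, ha⟩, i⟩ ⟨⟨b, hb⟩, j⟩ h
  simpa [prevIdx] using h

theorem prevIdx_ne (k : Fin p) (a : {j : Fin p // j < k} × Fin s) (b : Fin s) :
    prevIdx p s k a ≠ (k, b) := fun h => a.1.2.ne (congrArg Prod.fst h)

/-- A sum over all block indices whose terms after block `k` vanish. -/
theorem sum_eq_prev_add_block (k : Fin p) (g : Fin p × Fin s → ℝ) (hg : ∀ a, k < a.1 → g a = 0) :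
    ∑ a, g a = ∑ a, g (prevIdx p s k a) + ∑ b, g (k, b) := by
  rw [Fintype.sum_prod_type, Fintype.sum_prod_type]
  have h1 : ∑ j, ∑ b, g (j, b) = ∑ j ∈ Finset.Iic k, ∑ b, g (j, b) := by
    refine (Finset.sum_subset (Finset.subset_univ _) fun j _ hj => ?_).symm
    exact Finset.sum_eq_zero fun b _ => hg _ (by simpa using hj)
  rw [h1, ← Finset.Iio_insert, Finset.sum_insert (by simp), add_comm,
    Finset.sum_subtype (Finset.Iio k) (p := fun j => j < k) (by simp)]
  rfl

theorem mul_apply_block (Q : Matrix (Fin m) (Fin p × Fin s) ℝ)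
    {R : Matrix (Fin p × Fin s) (Fin p × Fin s) ℝ} (hR : ∀ i k : Fin p, k < i → block R i k = 0)
    (k : Fin p) (i : Fin m) (b : Fin s) :
    (Q * R) i (k, b) = (prevCols Q k * aboveDiag R k + blockCol Q k * block R k k) i b := by
  rw [Matrix.mul_apply, sum_eq_prev_add_block k]
  · rfl
  · intro a ha
    have : R a (k, b) = 0 := congrFun (congrFun (hR a.1 k ha) a.2) b
    rw [this, mul_zero]

/-- Block upper triangularity of R makes the leading columns of QR a product of leading parts. This
supplies the factorization X₀ ≈ QR₀ needed by the induction step. -/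
theorem mul_apply_prevIdx (Q : Matrix (Fin m) (Fin p × Fin s) ℝ)
    {R : Matrix (Fin p × Fin s) (Fin p × Fin s) ℝ} (hR : ∀ i k : Fin p, k < i → block R i k = 0)
    (k : Fin p) (i : Fin m) (b : {j : Fin p // j < k} × Fin s) :
    (Q * R) i (prevIdx p s k b) =
      (prevCols Q k * R.submatrix (prevIdx p s k) (prevIdx p s k)) i b := by
  have hz : ∀ a : Fin p × Fin s, k ≤ a.1 → Q i a * R a (prevIdx p s k b) = 0 := fun a ha => by
    have : R a (prevIdx p s k b) = 0 :=
      congrFun (congrFun (hR a.1 b.1.1 (b.1.2.trans_le ha)) a.2) b.2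
    rw [this, mul_zero]
  rw [Matrix.mul_apply, sum_eq_prev_add_block k _ fun a ha => hz a ha.le,
    Finset.sum_eq_zero fun c _ => hz (k, c) le_rfl, add_zero]
  rfl

end Blocks

/-! ### Induction over the block columns. -/

/-- Entrywise bounds for the leading `n` block columns computed by BCGSI+A. -/
theorem exists_leading_bound (m p : ℕ) {s : ℕ} (hs : 0 < s) (α₁ α₂ : ℝ) {c τ : ℝ} (hc : 0 < c)
    (hτ : 1 < τ) (n : ℕ) (hn : n ≤ p) :
    ∃ K C : ℝ, 0 < K ∧ 0 < C ∧ ∀ (ε σ : ℝ) (IOA IO1 IO2 : IntraOrtho m s)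
      (X Q : Matrix (Fin m) (Fin p × Fin s) ℝ) (R S T : Matrix (Fin p × Fin s) (Fin p × Fin s) ℝ)
      (U V H : Matrix (Fin m) (Fin p × Fin s) ℝ), 0 < ε → 0 < σ → σ ≤ ‖X‖ → BoundedBelow X σ →
      IOA.Stable c ε 0 (ENNReal.ofReal (‖X‖ / σ)) →
      IO1.Stable c ε α₁ (ENNReal.ofReal (τ * (‖X‖ / σ))) →
      IO2.Stable c ε α₂ (ENNReal.ofReal (τ * (‖X‖ / σ))) →
      BCGSIARun ε IOA IO1 IO2 X Q R S T U V H →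
      K * (ε * (‖X‖ / σ) ^ max α₁ 1) ≤ 1 →
      (∀ a b : Fin p × Fin s, a.1.val < n → b.1.val < n →
        |(1 - Qᵀ * Q : Matrix (Fin p × Fin s) (Fin p × Fin s) ℝ) a b| ≤ C * ε) ∧
      ∀ (i : Fin m) (b : Fin p × Fin s), b.1.val < n → |(X - Q * R) i b| ≤ C * ε * ‖X‖ := by
  have : Nonempty (Fin s) := ⟨⟨0, hs⟩⟩
  induction n with
  | zero => exact ⟨1, 1, one_pos, one_pos, by simp⟩
  | succ n ih =>
    obtain ⟨K, C, hK, hC, hbound⟩ := ih (by omega)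
    obtain ⟨k, hk⟩ : ∃ k : Fin p, k.val = n := ⟨⟨n, hn⟩, rfl⟩
    set N : ℝ := ((Fintype.card ({j : Fin p // j < k} × Fin s) : ℕ) : ℝ) with hN
    have hN0 : 0 ≤ N := Nat.cast_nonneg _
    -- Entrywise bounds glue together trivially when a block is added; recovering norms from them
    -- costs N² for the Gram matrix and mN for the residual.
    obtain ⟨K', C', hK', hC', hstep⟩ := exists_block_step_bound (m := m)
      ({j : Fin p // j < k} × Fin s) hs α₁ α₂ hc hτ
      (show 0 < (N * N + m * N + 1) * C by positivity)
    refine ⟨K + K', C + C' + c, by positivity, by positivity, ?_⟩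
    intro ε σ IOA IO1 IO2 X Q R S T U V H hε hσ hσX hX hA h1 h2 hrun hKε
    have hX0 : 0 < ‖X‖ := hσ.trans_le hσX
    have hω : 0 < ε * (‖X‖ / σ) ^ max α₁ 1 := by positivity
    have hKω := mul_pos hK hω
    have hKω' := mul_pos hK' hω
    obtain ⟨ho, hr⟩ := hbound ε σ IOA IO1 IO2 X Q R S T U V H hε hσ hσX hX hA h1 h2 hrun
      (by linarith)
    have hcols := hX.disjoint_cols hσ.le (prevIdx_injective (s := s) k) (g := fun b => (k, b))
      (Prod.mk_right_injective k) (prevIdx_ne k)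
    have hXk : ‖blockCol X k‖ ≤ ‖X‖ := l2_opNorm_submatrix_col_le X (Prod.mk_right_injective k)
    have hCle : C * ε ≤ (C + C' + c) * ε := mul_le_mul_of_nonneg_right (by linarith) hε.le
    have hCle' : C' * ε ≤ (C + C' + c) * ε := mul_le_mul_of_nonneg_right (by linarith) hε.le
    have hcle : c * ε ≤ (C + C' + c) * ε := mul_le_mul_of_nonneg_right (by linarith) hε.le
    -- bounds for block column `k`
    obtain ⟨hoff, hdiag, hres⟩ : ‖(prevCols Q k)ᵀ * blockCol Q k‖ ≤ (C + C' + c) * ε ∧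
        ‖1 - (blockCol Q k)ᵀ * blockCol Q k‖ ≤ (C + C' + c) * ε ∧
        ‖blockCol X k - (prevCols Q k * aboveDiag R k + blockCol Q k * block R k k)‖ ≤
          (C + C' + c) * ε * ‖X‖ := by
      -- The first block has no predecessors: its condition number is at most ‖X‖/σ, so `IOA`
      -- applies directly, and exponent 0 makes its loss cε.
      rcases Nat.eq_zero_or_pos n with rfl | hn0
      · have hempty : IsEmpty ({j : Fin p // j < k} × Fin s) :=
          ⟨fun a => by have := a.1.2; rw [Fin.lt_def] at this; omega⟩
        have hXkb : BoundedBelow (blockCol X k) σ := fun v => by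
          simpa [blockCol] using (hcols 0 v).2
        obtain ⟨⟨Δ, hΔ, hΔ2⟩, hQ⟩ := hA (blockCol X k) (hXkb.kappa_le hσ hXk)
        rw [← hrun.first k hk] at hΔ hQ
        rw [ENNReal.rpow_zero, mul_one, ENNReal.ofReal_le_ofReal_iff (by positivity)] at hQ
        refine ⟨?_, hQ.trans hcle, ?_⟩
        · rw [Subsingleton.elim ((prevCols Q k)ᵀ * blockCol Q k) 0, norm_zero]
          positivity
        · have h0 : prevCols Q k * aboveDiag R k = 0 := by
            ext i j; simp [Matrix.mul_apply]
          have hdec : blockCol X k - (0 + blockCol Q k * block R k k) = -Δ := by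
            rw [← hΔ]; abel
          rw [h0, hdec, norm_neg]
          exact hΔ2.trans (mul_le_mul hcle hXk (norm_nonneg _) (by positivity))
      · have hk0 : 0 < k.val := by omega
        have hC0 : ∀ {t : ℝ}, t ≤ N * N + m * N → t * (C * ε) ≤ (N * N + m * N + 1) * C * ε :=
          fun {t} ht => by
            rw [mul_assoc]
            exact mul_le_mul_of_nonneg_right (by linarith) (by positivity)
        have ho' : ‖1 - (prevCols Q k)ᵀ * prevCols Q k‖ ≤ (N * N + m * N + 1) * C * ε := by
          refine (l2_opNorm_le_of_entry_le (a := C * ε) (by positivity) fun a b => ?_).trans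
            (hC0 (le_add_of_nonneg_right (by positivity)))
          exact (congrArg abs (one_sub_gram_submatrix_apply Q (prevIdx_injective k) a b)).le.trans
            (ho (prevIdx p s k a) (prevIdx p s k b) (hk ▸ a.1.2) (hk ▸ b.1.2))
        have hr' : ‖X.submatrix id (prevIdx p s k) -
            prevCols Q k * R.submatrix (prevIdx p s k) (prevIdx p s k)‖ ≤
            (N * N + m * N + 1) * C * ε * ‖X‖ := by
          refine (l2_opNorm_le_of_entry_le (a := C * ε * ‖X‖) (by positivity)
            fun i b => ?_).trans ?_
          · have h3 := hr i (prevIdx p s k b) (hk ▸ b.1.2)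
            rwa [Matrix.sub_apply, mul_apply_prevIdx Q hrun.lower k] at h3
          · rw [Fintype.card_fin, ← hN, ← mul_assoc]
            exact mul_le_mul_of_nonneg_right
              (hC0 (le_add_of_nonneg_left (by positivity))) hX0.le
        obtain ⟨h3, h4, h5⟩ := hstep ε ‖X‖ σ hε hσ hσX (by linarith) IO1 IO2 h1 h2
          (prevCols Q k) (X.submatrix id (prevIdx p s k))
          (R.submatrix (prevIdx p s k) (prevIdx p s k)) (blockCol X k) (blockCol V k)
          (blockCol U k) (blockCol H k) (blockCol Q k) (aboveDiag S k) (aboveDiag T k)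
          (aboveDiag R k) (block S k k) (block T k k) (block R k k) hcols hXk ho' hr'
          (hrun.proj1 k hk0) (hrun.sub1 k hk0) (hrun.ortho1 k hk0) (hrun.proj2 k hk0)
          (hrun.sub2 k hk0) (hrun.ortho2 k hk0) (hrun.upper k hk0) (hrun.diag k hk0)
        exact ⟨h3.trans hCle', h4.trans hCle',
          h5.trans (mul_le_mul_of_nonneg_right hCle' hX0.le)⟩
    have hcases : ∀ a : Fin p × Fin s, a.1.val < n + 1 → a.1.val < n ∨ a = (k, a.2) :=
      fun a ha => (Nat.lt_succ_iff_lt_or_eq.mp ha).imp_right fun h =>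
        Prod.ext (Fin.ext (h.trans hk.symm)) rfl
    have hmixed : ∀ (a : Fin p × Fin s) (b : Fin s), a.1.val < n →
        |(1 - Qᵀ * Q : Matrix (Fin p × Fin s) (Fin p × Fin s) ℝ) a (k, b)| ≤ (C + C' + c) * ε := fun a b ha => by
      have hak : a.1 < k := by rw [Fin.lt_def, hk]; exact ha
      have h3 := (abs_entry_le_l2_opNorm _ (⟨a.1, hak⟩, a.2) b).trans hoff
      rw [Matrix.sub_apply, Matrix.one_apply_ne (fun h => hak.ne (congrArg Prod.fst h)),
        zero_sub, abs_neg]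
      exact h3
    constructor
    · intro a b ha hb
      rcases hcases a ha with ha' | ha' <;> rcases hcases b hb with hb' | hb'
      · exact (ho a b ha' hb').trans hCle
      · rw [hb']; exact hmixed a _ ha'
      · rw [one_sub_gram_apply_comm, ha']; exact hmixed b _ hb'
      · have h3 := (abs_entry_le_l2_opNorm _ a.2 b.2).trans hdiag
        rw [ha', hb']
        exact (congrArg abs (one_sub_gram_submatrix_apply Q
          (Prod.mk_right_injective k) a.2 b.2)).ge.trans h3
    · intro i b hb
      rcases hcases b hb with hb' | hb'
      · exact (hr i b hb').trans (mul_le_mul_of_nonneg_right hCle hX0.le)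
      · rw [hb', Matrix.sub_apply, mul_apply_block Q hrun.lower]
        exact (abs_entry_le_l2_opNorm _ i b.2).trans hres

end BlockGS

/-! ### From entrywise bounds to the theorem. -/

theorem mainTheorem1 (m p s : ℕ) (hm : p * s ≤ m) (α₁ α₂ c τ : ℝ) (hc : 0 < c) (hτ : 1 < τ) :
    ∃ K C : ℝ, 0 < K ∧ 0 < C ∧
      ∀ (ε : ℝ), 0 < ε →
      ∀ (IOA IO1 IO2 : BlockGS.IntraOrtho m s)
        (X Q : Matrix (Fin m) (Fin p × Fin s) ℝ)
        (R : Matrix (Fin p × Fin s) (Fin p × Fin s) ℝ),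
        IOA.Stable c ε 0 (BlockGS.kappa X) →
        IO1.Stable c ε α₁ (ENNReal.ofReal τ * BlockGS.kappa X) →
        IO2.Stable c ε α₂ (ENNReal.ofReal τ * BlockGS.kappa X) →
        BlockGS.IsComputedBCGSIA ε IOA IO1 IO2 X Q R →
        ENNReal.ofReal (K * ε) * BlockGS.kappa X ^ (max α₁ 1) < 1 →
        (∃ ΔX : Matrix (Fin m) (Fin p × Fin s) ℝ, X + ΔX = Q * R ∧ ‖ΔX‖ ≤ C * ε * ‖X‖) ∧
          ‖1 - Qᵀ * Q‖ ≤ C * ε := by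
  -- Without columns all the claims are trivial; the bounds on κ used below need at least one
  -- column.
  rcases isEmpty_or_nonempty (Fin p × Fin s) with hemp | hne
  · refine ⟨1, 1, one_pos, one_pos, ?_⟩
    intro ε hε IOA IO1 IO2 X Q R _ _ _ _ _
    refine ⟨⟨0, Subsingleton.elim _ _, ?_⟩, ?_⟩
    · rw [norm_zero]; positivity
    · rw [Subsingleton.elim (1 - Qᵀ * Q) 0, norm_zero]; positivity
  have hs : 0 < s := hne.some.2.pos
  obtain ⟨K, C, hK, hC, hbound⟩ := BlockGS.exists_leading_bound m p hs α₁ α₂ hc hτ p le_rfl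
  set N : ℝ := ((Fintype.card (Fin p × Fin s) : ℕ) : ℝ) with hN
  have hN0 : 0 ≤ N := Nat.cast_nonneg _
  refine ⟨K, (N * N + m * N + 1) * C, hK, by positivity, ?_⟩
  intro ε hε IOA IO1 IO2 X Q R hA h1 h2 hrun hsmall
  obtain ⟨S, T, U, V, H, hrun⟩ := hrun
  have hθ : 0 < max α₁ 1 := lt_max_of_lt_right one_pos
  -- Since θ > 0 and Kε > 0, an infinite κ would violate the smallness condition; so σ_min(X) > 0.
  have htop : BlockGS.kappa X ≠ ⊤ := fun h => by
    rw [h, ENNReal.top_rpow_of_pos hθ, ENNReal.mul_top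
      (ENNReal.ofReal_pos.mpr (by positivity)).ne'] at hsmall
    exact not_top_lt hsmall
  obtain ⟨hσ, hσX, hκ⟩ := BlockGS.kappa_eq_of_ne_top htop
  have hκ0 : 0 ≤ ‖X‖ / BlockGS.sigmaMin X := by positivity
  rw [hκ] at hA h1 h2 hsmall
  rw [← ENNReal.ofReal_mul (by positivity)] at h1 h2
  rw [ENNReal.ofReal_rpow_of_nonneg hκ0 hθ.le, ← ENNReal.ofReal_mul (by positivity),
    ENNReal.ofReal_lt_one, mul_assoc] at hsmall
  obtain ⟨ho, hr⟩ := hbound ε _ IOA IO1 IO2 X Q R S T U V H hε hσ hσX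
    (BlockGS.sigmaMin_mul_euclNorm_le X) hA h1 h2 hrun hsmall.le
  have hC0 : ∀ {t : ℝ}, t ≤ N * N + m * N → t * (C * ε) ≤ (N * N + m * N + 1) * C * ε :=
    fun {t} ht => by
      rw [mul_assoc]
      exact mul_le_mul_of_nonneg_right (by linarith) (by positivity)
  refine ⟨⟨Q * R - X, by abel, ?_⟩, ?_⟩
  · rw [norm_sub_rev]
    refine (BlockGS.l2_opNorm_le_of_entry_le (a := C * ε * ‖X‖) (by positivity)
      fun i b => hr i b b.1.2).trans ?_
    rw [Fintype.card_fin, ← hN, ← mul_assoc]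
    exact mul_le_mul_of_nonneg_right (hC0 (le_add_of_nonneg_left (by positivity))) (norm_nonneg X)
  · exact (BlockGS.l2_opNorm_le_of_entry_le (a := C * ε) (by positivity)
      fun a b => ho a b a.1.2 b.1.2).trans (hC0 (le_add_of_nonneg_right (by positivity)))
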